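/- Let $d\ge 1$ and let $(X_u)_{u\in\mathbb Z^d}$ be a stationary random field of mean-zero, finite-variance real random variables which satisfies the FKG inequalities: for every finite subfamily $(X_{u_1},\dots,X_{u_m})$ and all coordinatewise nondecreasing functions $F,G$ for which $F(X_{u_1},\dots,X_{u_m})$ and $G(X_{u_1},\dots,X_{u_m})$ have finite second moments, $\mathrm{Cov}(F(X_{u_1},\dots,X_{u_m}),G(X_{u_1},\dots,X_{u_m}))\ge 0$. Assume finite susceptibility: $\sum_{u\in\mathbb Z^d}\mathrm{Cov}(X_0,X_u)<\infty$. Fix $\tau>0$ and let $(Z_u)_{u\in\mathbb Z^d}$ be $N(0,\tau)$ random variables independent of the field $X$ and of each other. For $x\in\{1,2,\dots\}^d$ let $B_x=\{y\in\mathbb Z^d: 1\le y_i\le x_i \text{ for all } i\}$, $|x|=|B_x|=\prod_i x_i$, and $$V_x=\frac1{\sqrt{|x|}}\sum_{u\in B_x}(X_u+Z_u).$$ For a random variable $U$ with variance $\sigma^2$ and smooth density $f$, let $J_{\rm st}(U)=\sigma^2\,\mathbb E\big[(f'(U)/f(U))^2\big]-1$ be its standardised Fisher information. Then $$\lim_{n\to\infty}\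 \sup_{x:\,|x|=n} J_{\rm st}(V_x)=0$$ if and only if the family $(V_x)$ is uniformly integrable in the following sense: there exists a function $\psi:\mathbb R\to\mathbb R$ with $\psi(R)\to0$ as $R\to\infty$ such that, for all $x\in\{1,2,\dots\}^d$ and all $R$, $$\mathbb E\big[V_x^2\,\mathbf 1(|V_x|\ge R\,\sigma_x)\big]\le\sigma_x^2\,\psi(R),\qquad \sigma_x^2=\mathrm{Var}(V_x).$$ -/

import Mathlib

open MeasureTheory ProbabilityTheory Filter Topology
open scoped NNReal ENNReal

noncomputable section

namespace FKGField

/-- `f` is a (version of the) continuously differentiable Lebesgue density of the law `μ` on `ℝ`.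
Such an `f`, if it exists, is unique. -/
structure IsSmoothDensity (f : ℝ → ℝ) (μ : Measure ℝ) : Prop where
  contDiff : ContDiff ℝ 1 f
  nonneg : ∀ x, 0 ≤ f x
  eq_withDensity : μ = volume.withDensity (fun x => ENNReal.ofReal (f x))

/-- The score function `ρ = f' / f` of a density `f`. -/
def score (f : ℝ → ℝ) (x : ℝ) : ℝ := deriv f x / f x

/-- The Fisher information `J(U) = E ρ(U)²`, with values in `[0, ∞]`. As the smooth density of `U`
is unique, the infimum is over at most one function; `J(U) = ∞` if there is no smooth density. -/
def fisherInfo {Ω : Type*} [MeasurableSpace Ω] (U : Ω → ℝ) (P : Measure Ω) : ℝ≥0∞ :=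
  ⨅ (f : ℝ → ℝ) (_ : IsSmoothDensity f (P.map U)), ∫⁻ ω, ENNReal.ofReal (score f (U ω) ^ 2) ∂P

/-- The standardised Fisher information `J_st(U) = σ² J(U) - 1`, where `σ² = Var U`. -/
def stdFisherInfo {Ω : Type*} [MeasurableSpace Ω] (U : Ω → ℝ) (P : Measure Ω) : EReal :=
  ((ENNReal.ofReal (Var[U; P]) * fisherInfo U P : ℝ≥0∞) : EReal) - 1

/-- The FKG property of a family of random variables: for every finite subfamily, coordinatewise
nondecreasing (Borel) functions of it have nonnegative covariance, whenever they have finite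
second moments. -/
def IsFKG {ι Ω : Type*} [MeasurableSpace Ω] (X : ι → Ω → ℝ) (P : Measure Ω) : Prop :=
  ∀ (s : Finset ι) (F G : (s → ℝ) → ℝ), Monotone F → Monotone G → Measurable F → Measurable G →
    MemLp (fun ω => F (fun i => X i ω)) 2 P → MemLp (fun ω => G (fun i => X i ω)) 2 P →
    0 ≤ cov[fun ω => F (fun i => X i ω), fun ω => G (fun i => X i ω); P]

/-- Stationarity of a random field on `ℤ^d`: all translates have the same joint law. -/
def IsStationary {d : ℕ} {Ω : Type*} [MeasurableSpace Ω] (X : (Fin d → ℤ) → Ω → ℝ)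
    (P : Measure Ω) : Prop :=
  ∀ a : Fin d → ℤ,
    P.map (fun ω (u : Fin d → ℤ) => X (u + a) ω) = P.map (fun ω (u : Fin d → ℤ) => X u ω)

/-- The box `{y ∈ ℤ^d : 1 ≤ y_i ≤ x_i for all i}` with side lengths `x_i`. -/
def box {d : ℕ} (x : Fin d → ℕ) : Finset (Fin d → ℤ) :=
  Fintype.piFinset fun i => Finset.Icc 1 (x i : ℤ)

/-- The volume `∏ x_i` of a box. -/
def boxVolume {d : ℕ} (x : Fin d → ℕ) : ℕ := ∏ i, x i

theorem card_box {d : ℕ} (x : Fin d → ℕ) : (box x).card = boxVolume x := by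
  simp [box, boxVolume]

/-- The normalised perturbed sum `V_x = |x|^{-1/2} ∑_{u ∈ B_x} (X_u + Z_u)`. -/
def perturbedSum {d : ℕ} {Ω : Type*} (X Z : (Fin d → ℤ) → Ω → ℝ) (x : Fin d → ℕ) (ω : Ω) : ℝ :=
  (∑ u ∈ box x, (X u ω + Z u ω)) / √(boxVolume x : ℝ)

/-- The class `C_ψ`: `U` has finite variance `σ²`, and
`E U² 1(|U| ≥ R σ) ≤ σ² ψ(R)` for all `R`. -/
def MemClass {Ω : Type*} [MeasurableSpace Ω] (ψ : ℝ → ℝ) (U : Ω → ℝ) (P : Measure Ω) : Prop :=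
  MemLp U 2 P ∧
    ∀ R : ℝ, ∫ ω in {ω | R * √(Var[U; P]) ≤ |U ω|}, U ω ^ 2 ∂P ≤ Var[U; P] * ψ R

end FKGField

end

/-!
Both sides of the equivalence hold, and both come from Newman's central limit theorem along boxes
of growing volume and arbitrary shape.

For square integrable increasing functions `U`, `V` of an FKG field the characteristic function of
`U + V` differs from the product of those of `U` and `V` by a multiple of `Cov(U, V)`. So the
characteristic function of a box sum is close to a power of that of a smaller box, the error being
governed by the difference of the variances per site of the two boxes; these are bounded by the
susceptibility, hence converge along subsequences, and there the normalised sums converge to a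
Gaussian law whose variance is the limit `s`.

The Fisher information of `μ ∗ N(0, τ)` is continuous in `μ` for weak convergence, so along such a
subsequence that of `V_x` tends to that of `N(0, s + τ)`, which is `(s + τ)⁻¹`. Convergence in
distribution together with convergence of the variances gives uniform integrability of `V_x²`.
-/

namespace FKGField

section Increasing

variable {ι Ω : Type*} {X : ι → Ω → ℝ} {U V : Ω → ℝ}

/-- `U` is a coordinatewise nondecreasing Borel function of finitely many members of the
family `X`. -/
def IsIncreasing (X : ι → Ω → ℝ) (U : Ω → ℝ) : Prop :=
  ∃ (s : Finset ι) (F : (s → ℝ) → ℝ), Monotone F ∧ Measurable F ∧ U = fun ω => F fun i => X i ω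

theorem IsIncreasing.exists_common (hU : IsIncreasing X U) (hV : IsIncreasing X V) :
    ∃ (s : Finset ι) (F G : (s → ℝ) → ℝ),
      (Monotone F ∧ Measurable F ∧ U = fun ω => F fun i => X i ω) ∧
        Monotone G ∧ Measurable G ∧ V = fun ω => G fun i => X i ω := by
  classical
  have extend : ∀ {s t : Finset ι} {F : (s → ℝ) → ℝ} (hst : s ⊆ t), Monotone F → Measurable F →
      Monotone (fun z : t → ℝ => F fun i => z ⟨i, hst i.2⟩) ∧
        Measurable (fun z : t → ℝ => F fun i => z ⟨i, hst i.2⟩) := fun hst hF hFm =>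
    ⟨fun _ _ h => hF fun _ => h _, hFm.comp (by fun_prop)⟩
  obtain ⟨s, F, hF, hFm, rfl⟩ := hU
  obtain ⟨t, G, hG, hGm, rfl⟩ := hV
  have hF' := extend (Finset.subset_union_left (s₂ := t)) hF hFm
  have hG' := extend (Finset.subset_union_right (s₁ := s)) hG hGm
  exact ⟨s ∪ t, _, _, ⟨hF'.1, hF'.2, rfl⟩, hG'.1, hG'.2, rfl⟩

theorem isIncreasing_apply (i : ι) : IsIncreasing X (X i) :=
  ⟨{i}, fun z => z ⟨i, by simp⟩, fun _ _ h => h _, measurable_pi_apply _, rfl⟩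

theorem isIncreasing_zero : IsIncreasing X fun _ => 0 :=
  ⟨∅, fun _ => 0, monotone_const, measurable_const, rfl⟩

theorem IsIncreasing.add (hU : IsIncreasing X U) (hV : IsIncreasing X V) :
    IsIncreasing X fun ω => U ω + V ω := by
  obtain ⟨s, F, G, ⟨hF, hFm, rfl⟩, hG, hGm, rfl⟩ := hU.exists_common hV
  exact ⟨s, fun z => F z + G z, hF.add hG, hFm.add hGm, rfl⟩

theorem IsIncreasing.comp (hU : IsIncreasing X U) {g : ℝ → ℝ} (hg : Monotone g) :
    IsIncreasing X fun ω => g (U ω) := by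
  obtain ⟨s, F, hF, hFm, rfl⟩ := hU
  exact ⟨s, fun z => g (F z), hg.comp hF, hg.measurable.comp hFm, rfl⟩

theorem isIncreasing_sum {α : Type*} (Q : Finset α) {U : α → Ω → ℝ}
    (hU : ∀ a, IsIncreasing X (U a)) : IsIncreasing X fun ω => ∑ a ∈ Q, U a ω := by
  classical
  induction Q using Finset.induction_on with
  | empty => simpa only [Finset.sum_empty] using isIncreasing_zero
  | insert b Q hb ih =>
    simp_rw [Finset.sum_insert hb]
    exact (hU b).add ih

end Increasing

section Covariance

theorem monotone_mul_add_of_lipschitzWith {f : ℝ → ℝ} {K : ℝ≥0} (hf : LipschitzWith K f) :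
    Monotone fun x => K * x + f x := fun a b hab => by
  have h := neg_le_of_abs_le (hf.dist_le_mul b a)
  rw [Real.dist_eq, abs_of_nonneg (sub_nonneg.2 hab)] at h
  dsimp only
  linarith

theorem memLp_comp_of_lipschitzWith {Ω : Type*} [MeasurableSpace Ω] {P : Measure Ω}
    [IsFiniteMeasure P] {p : ℝ≥0∞} {U : Ω → ℝ} (hU : MemLp U p P) {f : ℝ → ℝ} {K : ℝ≥0}
    (hf : LipschitzWith K f) : MemLp (fun ω => f (U ω)) p P := by
  have hf0 : LipschitzWith K fun x => f x - f 0 := by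
    simpa using hf.sub (LipschitzWith.const (f 0))
  have h : MemLp (fun ω => (f (U ω) - f 0) + f 0) p P :=
    (hf0.comp_memLp (sub_self _) hU).add (memLp_const _)
  simpa only [sub_add_cancel] using h

variable {ι Ω : Type*} {X : ι → Ω → ℝ} [MeasurableSpace Ω] {P : Measure Ω} {U V : Ω → ℝ}

theorem covariance_add_add_covariance_sub_sub [IsFiniteMeasure P] {A B C D : Ω → ℝ}
    (hA : MemLp A 2 P) (hB : MemLp B 2 P) (hC : MemLp C 2 P) (hD : MemLp D 2 P) :
    cov[A + B, C + D; P] + cov[A - B, C - D; P] = 2 * (cov[A, C; P] + cov[B, D; P]) := by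
  rw [covariance_add_left hA hB (hC.add hD), covariance_add_right hA hC hD,
    covariance_add_right hB hC hD, covariance_sub_left hA hB (hC.sub hD),
    covariance_sub_right hA hC hD, covariance_sub_right hB hC hD]
  ring

theorem IsFKG.cov_nonneg (hX : IsFKG X P) (hU : IsIncreasing X U) (hV : IsIncreasing X V)
    (hU2 : MemLp U 2 P) (hV2 : MemLp V 2 P) : 0 ≤ cov[U, V; P] := by
  obtain ⟨s, F, G, ⟨hF, hFm, rfl⟩, hG, hGm, rfl⟩ := hU.exists_common hV
  exact hX s F G hF hG hFm hGm hU2 hV2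

variable [IsProbabilityMeasure P]

theorem IsFKG.neg_mul_cov_le_cov_comp (hX : IsFKG X P) (hU : IsIncreasing X U)
    (hV : IsIncreasing X V) (hU2 : MemLp U 2 P) (hV2 : MemLp V 2 P) {f g : ℝ → ℝ} {K L : ℝ≥0}
    (hf : LipschitzWith K f) (hg : LipschitzWith L g) :
    -(K * L * cov[U, V; P]) ≤ cov[fun ω => f (U ω), fun ω => g (V ω); P] := by
  have mKU : MemLp (fun ω => K * U ω) 2 P := hU2.const_mul _
  have mLV : MemLp (fun ω => L * V ω) 2 P := hV2.const_mul _
  have mf := memLp_comp_of_lipschitzWith hU2 hf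
  have mg := memLp_comp_of_lipschitzWith hV2 hg
  have h_add : 0 ≤ cov[(fun ω => K * U ω) + fun ω => f (U ω),
      (fun ω => L * V ω) + fun ω => g (V ω); P] :=
    hX.cov_nonneg (hU.comp (monotone_mul_add_of_lipschitzWith hf))
      (hV.comp (monotone_mul_add_of_lipschitzWith hg)) (mKU.add mf) (mLV.add mg)
  have h_sub : 0 ≤ cov[(fun ω => K * U ω) + -fun ω => f (U ω),
      (fun ω => L * V ω) + -fun ω => g (V ω); P] :=
    hX.cov_nonneg (hU.comp (monotone_mul_add_of_lipschitzWith hf.neg))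
      (hV.comp (monotone_mul_add_of_lipschitzWith hg.neg)) (mKU.add mf.neg) (mLV.add mg.neg)
  have key := covariance_add_add_covariance_sub_sub mKU mf mLV mg
  rw [covariance_const_mul_left, covariance_const_mul_right] at key
  simp only [sub_eq_add_neg] at key
  linarith

theorem IsFKG.abs_cov_comp_le (hX : IsFKG X P) (hU : IsIncreasing X U) (hV : IsIncreasing X V)
    (hU2 : MemLp U 2 P) (hV2 : MemLp V 2 P) {f g : ℝ → ℝ} {K L : ℝ≥0}
    (hf : LipschitzWith K f) (hg : LipschitzWith L g) :
    |cov[fun ω => f (U ω), fun ω => g (V ω); P]| ≤ K * L * cov[U, V; P] := by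
  have h := hX.neg_mul_cov_le_cov_comp hU hV hU2 hV2 hf.neg hg
  simp only [Pi.neg_apply, covariance_fun_neg_left] at h
  exact abs_le.2 ⟨hX.neg_mul_cov_le_cov_comp hU hV hU2 hV2 hf hg, by linarith⟩

end Covariance

section CharFun

variable {Ω : Type*} [MeasurableSpace Ω] {P : Measure Ω} {U V : Ω → ℝ}

theorem charFun_map_mul_eq {c t : ℝ} (hU : AEMeasurable U P) :
    charFun (P.map fun ω => c * U ω) t = charFun (P.map U) (c * t) := by
  rw [← charFun_map_mul, AEMeasurable.map_map_of_aemeasurable (by fun_prop) hU]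
  rfl

variable [IsProbabilityMeasure P]

theorem charFun_map_eq_cos_add_sin (hU : AEMeasurable U P) (t : ℝ) :
    charFun (P.map U) t = ((∫ ω, Real.cos (t * U ω) ∂P : ℝ) : ℂ) +
      ((∫ ω, Real.sin (t * U ω) ∂P : ℝ) : ℂ) * Complex.I := by
  have bounded : ∀ {g : ℝ → ℂ}, Measurable g → (∀ x, ‖g x‖ ≤ 1) →
      Integrable (fun ω => g (U ω)) P := fun hg hb =>
    .of_bound (hg.comp_aemeasurable hU).aestronglyMeasurable 1 (ae_of_all _ fun _ => hb _)
  rw [charFun_apply_real, integral_map hU (by fun_prop), ← integral_complex_ofReal,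
    ← integral_complex_ofReal, ← integral_mul_const, ← integral_add]
  · refine integral_congr_ae (ae_of_all _ fun ω => ?_)
    dsimp only
    rw [← Complex.ofReal_mul, Complex.exp_mul_I, Complex.ofReal_cos, Complex.ofReal_sin]
  · refine bounded (g := fun x => (Real.cos (t * x) : ℂ)) (by fun_prop) fun x => ?_
    simpa only [Complex.norm_real, Real.norm_eq_abs] using Real.abs_cos_le_one (t * x)
  · refine bounded (g := fun x => (Real.sin (t * x) : ℂ) * Complex.I) (by fun_prop) fun x => ?_
    simpa only [norm_mul, Complex.norm_I, mul_one, Complex.norm_real, Real.norm_eq_abs] using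
      Real.abs_sin_le_one (t * x)

theorem memLp_cos_mul (hU : AEMeasurable U P) (t : ℝ) :
    MemLp (fun ω => Real.cos (t * U ω)) 2 P :=
  .of_bound (C := 1) (by fun_prop) (ae_of_all _ fun _ => Real.abs_cos_le_one _)

theorem memLp_sin_mul (hU : AEMeasurable U P) (t : ℝ) :
    MemLp (fun ω => Real.sin (t * U ω)) 2 P :=
  .of_bound (C := 1) (by fun_prop) (ae_of_all _ fun _ => Real.abs_sin_le_one _)

theorem charFun_map_add_sub_mul (hU : AEMeasurable U P) (hV : AEMeasurable V P) (t : ℝ) :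
    charFun (P.map fun ω => U ω + V ω) t - charFun (P.map U) t * charFun (P.map V) t =
      ((cov[fun ω => Real.cos (t * U ω), fun ω => Real.cos (t * V ω); P]
        - cov[fun ω => Real.sin (t * U ω), fun ω => Real.sin (t * V ω); P] : ℝ) : ℂ)
      + ((cov[fun ω => Real.sin (t * U ω), fun ω => Real.cos (t * V ω); P]
        + cov[fun ω => Real.cos (t * U ω), fun ω => Real.sin (t * V ω); P] : ℝ) : ℂ)
        * Complex.I := by
  have cU := memLp_cos_mul hU t
  have cV := memLp_cos_mul hV t
  have sU := memLp_sin_mul hU t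
  have sV := memLp_sin_mul hV t
  have cos_add : ∫ ω, Real.cos (t * (U ω + V ω)) ∂P =
      (∫ ω, Real.cos (t * U ω) * Real.cos (t * V ω) ∂P)
        - ∫ ω, Real.sin (t * U ω) * Real.sin (t * V ω) ∂P := by
    simp_rw [mul_add, Real.cos_add]
    exact integral_sub (cU.integrable_mul cV) (sU.integrable_mul sV)
  have sin_add : ∫ ω, Real.sin (t * (U ω + V ω)) ∂P =
      (∫ ω, Real.sin (t * U ω) * Real.cos (t * V ω) ∂P)
        + ∫ ω, Real.cos (t * U ω) * Real.sin (t * V ω) ∂P := by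
    simp_rw [mul_add, Real.sin_add]
    exact integral_add (sU.integrable_mul cV) (cU.integrable_mul sV)
  rw [covariance_eq_sub cU cV, covariance_eq_sub sU sV, covariance_eq_sub sU cV,
    covariance_eq_sub cU sV, charFun_map_eq_cos_add_sin (by fun_prop),
    charFun_map_eq_cos_add_sin hU, charFun_map_eq_cos_add_sin hV, cos_add, sin_add]
  simp only [Pi.mul_apply]
  push_cast
  linear_combination (-((∫ ω, Real.sin (t * U ω) ∂P : ℝ) : ℂ) *
    ((∫ ω, Real.sin (t * V ω) ∂P : ℝ) : ℂ)) * Complex.I_sq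

theorem norm_charFun_map_sub_le (hU : Integrable U P) (hV : Integrable V P) (t : ℝ) :
    ‖charFun (P.map U) t - charFun (P.map V) t‖ ≤ |t| * ∫ ω, |U ω - V ω| ∂P := by
  have mU := hU.aemeasurable
  have mV := hV.aemeasurable
  have bounded : ∀ {W : Ω → ℝ}, AEMeasurable W P →
      Integrable (fun ω => Complex.exp (t * W ω * Complex.I)) P := fun hW =>
    .of_bound (by fun_prop) 1 (ae_of_all _ fun ω => by
      rw [← Complex.ofReal_mul, Complex.norm_exp_ofReal_mul_I])
  rw [charFun_apply_real, charFun_apply_real, integral_map mU (by fun_prop),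
    integral_map mV (by fun_prop), ← integral_sub (bounded mU) (bounded mV), ← integral_const_mul]
  refine norm_integral_le_of_norm_le ((hU.sub hV).abs.const_mul _) (ae_of_all _ fun ω => ?_)
  have factor : Complex.exp (t * U ω * Complex.I) - Complex.exp (t * V ω * Complex.I) =
      Complex.exp ((t * V ω : ℝ) * Complex.I) *
        (Complex.exp (Complex.I * (t * (U ω - V ω) : ℝ)) - 1) := by
    rw [mul_sub, ← Complex.exp_add, mul_one]
    push_cast
    ring_nf
  rw [factor, norm_mul, Complex.norm_exp_ofReal_mul_I, one_mul]
  exact Real.norm_exp_I_mul_ofReal_sub_one_le.trans_eq (abs_mul _ _)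

theorem integral_abs_le_sqrt_variance (hU : MemLp U 2 P) (hU0 : ∫ ω, U ω ∂P = 0) :
    ∫ ω, |U ω| ∂P ≤ √(Var[U; P]) := by
  have h := variance_nonneg |U| P
  simp only [variance_eq_sub hU.abs, sub_nonneg, Pi.pow_apply, Pi.abs_apply, sq_abs] at h
  rw [variance_of_integral_eq_zero hU.aemeasurable hU0]
  exact Real.le_sqrt_of_sq_le h

end CharFun

section Newman

variable {ι Ω : Type*} {X : ι → Ω → ℝ} [MeasurableSpace Ω] {P : Measure Ω}
  [IsProbabilityMeasure P] {U V : Ω → ℝ}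

theorem IsFKG.norm_charFun_add_sub_mul_le (hX : IsFKG X P) (hU : IsIncreasing X U)
    (hV : IsIncreasing X V) (hU2 : MemLp U 2 P) (hV2 : MemLp V 2 P) (t : ℝ) :
    ‖charFun (P.map fun ω => U ω + V ω) t - charFun (P.map U) t * charFun (P.map V) t‖ ≤
      4 * t ^ 2 * cov[U, V; P] := by
  have lip_mul : LipschitzWith ‖t‖₊ fun x : ℝ => t * x := lipschitzWith_smul t
  have lip_cos := Real.lipschitzWith_cos.comp lip_mul
  have lip_sin := Real.lipschitzWith_sin.comp lip_mul
  have bound : ((1 * ‖t‖₊ : ℝ≥0) : ℝ) * (1 * ‖t‖₊ : ℝ≥0) = t ^ 2 := by simp [← sq]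
  have cc := hX.abs_cov_comp_le hU hV hU2 hV2 lip_cos lip_cos
  have ss := hX.abs_cov_comp_le hU hV hU2 hV2 lip_sin lip_sin
  have sc := hX.abs_cov_comp_le hU hV hU2 hV2 lip_sin lip_cos
  have cs := hX.abs_cov_comp_le hU hV hU2 hV2 lip_cos lip_sin
  simp only [bound, Function.comp_apply] at cc ss sc cs
  rw [charFun_map_add_sub_mul hU2.aemeasurable hV2.aemeasurable]
  refine (norm_add_le _ _).trans ?_
  rw [norm_mul, Complex.norm_I, mul_one, Complex.norm_real, Complex.norm_real]
  refine (add_le_add (norm_sub_le _ _) (norm_add_le _ _)).trans ?_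
  simp only [Real.norm_eq_abs]
  linarith

variable {α : Type*} (Q : Finset α) {W : α → Ω → ℝ}

theorem IsFKG.norm_charFun_sum_sub_prod_le (hX : IsFKG X P) (hW : ∀ a, IsIncreasing X (W a))
    (hW2 : ∀ a, MemLp (W a) 2 P) (t : ℝ) :
    ‖charFun (P.map fun ω => ∑ a ∈ Q, W a ω) t - ∏ a ∈ Q, charFun (P.map (W a)) t‖ ≤
      2 * t ^ 2 * (Var[fun ω => ∑ a ∈ Q, W a ω; P] - ∑ a ∈ Q, Var[W a; P]) := by
  classical
  induction Q using Finset.induction_on with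
  | empty => simp [show Var[fun _ : Ω => (0 : ℝ); P] = 0 from variance_zero P]
  | insert b Q hb ih =>
    set S : Ω → ℝ := fun ω => ∑ a ∈ Q, W a ω
    have hS : MemLp S 2 P := memLp_finsetSum Q fun a _ => hW2 a
    have := Measure.isProbabilityMeasure_map (hW2 b).aemeasurable
    simp_rw [Finset.sum_insert hb, Finset.prod_insert hb]
    calc ‖charFun (P.map fun ω => W b ω + S ω) t
          - charFun (P.map (W b)) t * ∏ a ∈ Q, charFun (P.map (W a)) t‖
        ≤ ‖charFun (P.map fun ω => W b ω + S ω) t - charFun (P.map (W b)) t * charFun (P.map S) t‖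
          + ‖charFun (P.map (W b)) t‖ *
            ‖charFun (P.map S) t - ∏ a ∈ Q, charFun (P.map (W a)) t‖ := by
          rw [← norm_mul, mul_sub]
          exact norm_sub_le_norm_sub_add_norm_sub _ _ _
      _ ≤ 4 * t ^ 2 * cov[W b, S; P] +
            1 * (2 * t ^ 2 * (Var[S; P] - ∑ a ∈ Q, Var[W a; P])) := by
          gcongr
          exacts [hX.norm_charFun_add_sub_mul_le (hW b) (isIncreasing_sum Q hW) (hW2 b) hS t,
            norm_charFun_le_one t]
      _ = _ := by
          rw [variance_fun_add (hW2 b) hS]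
          ring

theorem IsFKG.sum_variance_le (hX : IsFKG X P) (hW : ∀ a, IsIncreasing X (W a))
    (hW2 : ∀ a, MemLp (W a) 2 P) :
    ∑ a ∈ Q, Var[W a; P] ≤ Var[fun ω => ∑ a ∈ Q, W a ω; P] := by
  linarith [(norm_nonneg _).trans (hX.norm_charFun_sum_sub_prod_le Q hW hW2 1)]

theorem IsFKG.sum_variance_le_variance_add (hX : IsFKG X P) (hW : ∀ a, IsIncreasing X (W a))
    (hW2 : ∀ a, MemLp (W a) 2 P) (hV : IsIncreasing X V) (hV2 : MemLp V 2 P) :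
    ∑ a ∈ Q, Var[W a; P] + Var[V; P] ≤ Var[fun ω => ∑ a ∈ Q, W a ω + V ω; P] := by
  have hS2 : MemLp (fun ω => ∑ a ∈ Q, W a ω) 2 P := memLp_finsetSum Q fun a _ => hW2 a
  rw [variance_fun_add hS2 hV2]
  linarith [hX.sum_variance_le Q hW hW2, hX.cov_nonneg (isIncreasing_sum Q hW) hV hS2 hV2]

theorem IsFKG.norm_charFun_sum_add_sub_prod_le (hX : IsFKG X P)
    (hW : ∀ a, IsIncreasing X (W a)) (hW2 : ∀ a, MemLp (W a) 2 P) (hV : IsIncreasing X V)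
    (hV2 : MemLp V 2 P) (hV0 : ∫ ω, V ω ∂P = 0) {D : ℝ}
    (hD : Var[fun ω => ∑ a ∈ Q, W a ω + V ω; P] - ∑ a ∈ Q, Var[W a; P] = D) (t : ℝ) :
    ‖charFun (P.map fun ω => ∑ a ∈ Q, W a ω + V ω) t - ∏ a ∈ Q, charFun (P.map (W a)) t‖ ≤
      |t| * √D + 2 * t ^ 2 * D := by
  set S : Ω → ℝ := fun ω => ∑ a ∈ Q, W a ω
  have hS2 : MemLp S 2 P := memLp_finsetSum Q fun a _ => hW2 a
  have hVD : Var[V; P] ≤ D := by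
    linarith [hX.sum_variance_le_variance_add Q hW hW2 hV hV2]
  have hSD : Var[S; P] - ∑ a ∈ Q, Var[W a; P] ≤ D := by
    rw [← hD, variance_fun_add hS2 hV2]
    linarith [hX.cov_nonneg (isIncreasing_sum Q hW) hV hS2 hV2, variance_nonneg V P]
  calc ‖charFun (P.map fun ω => S ω + V ω) t - ∏ a ∈ Q, charFun (P.map (W a)) t‖
      ≤ ‖charFun (P.map fun ω => S ω + V ω) t - charFun (P.map S) t‖
        + ‖charFun (P.map S) t - ∏ a ∈ Q, charFun (P.map (W a)) t‖ :=
        norm_sub_le_norm_sub_add_norm_sub _ _ _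
    _ ≤ |t| * ∫ ω, |V ω| ∂P + 2 * t ^ 2 * (Var[S; P] - ∑ a ∈ Q, Var[W a; P]) := by
        gcongr
        · have hSV : Integrable (fun ω => S ω + V ω) P := (hS2.add hV2).integrable one_le_two
          simpa only [add_sub_cancel_left] using
            norm_charFun_map_sub_le hSV (hS2.integrable one_le_two) t
        · exact hX.norm_charFun_sum_sub_prod_le Q hW hW2 t
    _ ≤ |t| * √D + 2 * t ^ 2 * D := by
        gcongr
        exact (integral_abs_le_sqrt_variance hV2 hV0).trans (Real.sqrt_le_sqrt hVD)

end Newman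

section CharFunPow

variable {Ω : Type*} [MeasurableSpace Ω] {P : Measure Ω} {U : Ω → ℝ} {α : Type*} {l : Filter α}

theorem tendsto_one_add_pow_exp {k : α → ℕ} {u : α → ℂ} {c : ℂ} (hu : Tendsto u l (𝓝 0))
    (hku : Tendsto (fun x => k x * u x) l (𝓝 c)) :
    Tendsto (fun x => (1 + u x) ^ k x) l (𝓝 (Complex.exp c)) := by
  have hlog : Tendsto (fun x => k x * (Complex.log (1 + u x) - u x)) l (𝓝 0) := by
    have hO := (Asymptotics.isBigO_refl (fun x => (k x : ℂ)) l).mul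
      (Complex.log_sub_self_isBigO.comp_tendsto hu)
    refine hO.trans_tendsto ?_
    simpa [Function.comp_def, sq, mul_assoc] using hku.mul hu
  have hexp := (Complex.continuous_exp.tendsto _).comp (hlog.add hku)
  rw [zero_add] at hexp
  refine hexp.congr' ?_
  filter_upwards [hu.eventually_ne (show (0 : ℂ) ≠ -1 by simp)] with x hx
  have hne : 1 + u x ≠ 0 := fun h => hx (eq_neg_of_add_eq_zero_right h)
  rw [Function.comp_apply, ← mul_add, sub_add_cancel, Complex.exp_nat_mul, Complex.exp_log hne]

variable [IsProbabilityMeasure P]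

theorem charFun_map_sub_one_add_isLittleO (hU : MemLp U 2 P) (hU0 : ∫ ω, U ω ∂P = 0) :
    (fun u : ℝ => charFun (P.map U) u - 1 + (Var[U; P] : ℂ) / 2 * (u : ℂ) ^ 2) =o[𝓝 0]
      fun u => u ^ 2 := by
  have mU := hU.aemeasurable
  have := Measure.isProbabilityMeasure_map mU
  have hid : MemLp id 2 (P.map U) := (memLp_map_measure_iff (by fun_prop) mU).2 hU
  have h := taylor_isLittleO_univ (n := 2) (x₀ := 0) (contDiff_charFun hid)
  have hsq : ∫ x, (U ^ 2) x ∂P = Var[U; P] := (variance_of_integral_eq_zero mU hU0).symm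
  simp only [taylorWithinEval_charFun_two_zero mU hid, hU0, hsq, sub_zero] at h
  refine h.congr_left fun u => ?_
  push_cast
  ring

theorem tendsto_charFun_pow (hU : MemLp U 2 P) (hU0 : ∫ ω, U ω ∂P = 0) {k : α → ℕ} {θ : α → ℝ}
    {c : ℝ} (hθ : Tendsto θ l (𝓝 0)) (hkθ : Tendsto (fun x => k x * θ x ^ 2) l (𝓝 c)) :
    Tendsto (fun x => charFun (P.map U) (θ x) ^ k x) l
      (𝓝 (Complex.exp (-(c * Var[U; P] / 2 : ℝ)))) := by
  have := Measure.isProbabilityMeasure_map hU.aemeasurable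
  have hφ : Tendsto (fun x => charFun (P.map U) (θ x) - 1) l (𝓝 0) := by
    have := (continuous_charFun (μ := P.map U)).tendsto 0 |>.comp hθ
    simpa using this.sub_const 1
  have hrem : Tendsto (fun x => (k x : ℂ) *
      (charFun (P.map U) (θ x) - 1 + (Var[U; P] : ℂ) / 2 * (θ x : ℂ) ^ 2)) l (𝓝 0) := by
    have ho := (Asymptotics.isBigO_refl (fun x => (k x : ℝ)) l).mul_isLittleO
      ((charFun_map_sub_one_add_isLittleO hU hU0).comp_tendsto hθ).norm_left
    refine squeeze_zero_norm (fun x => ?_)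
      ((Asymptotics.isLittleO_one_iff ℝ).1 (ho.trans_isBigO (hkθ.isBigO_one ℝ)))
    simp
  have hmain : Tendsto (fun x => (k x : ℂ) * (charFun (P.map U) (θ x) - 1)) l
      (𝓝 (-(c * Var[U; P] / 2 : ℝ))) := by
    have hsq : Tendsto (fun x => ((k x * θ x ^ 2 * (Var[U; P] / 2) : ℝ) : ℂ)) l
        (𝓝 (c * (Var[U; P] / 2) : ℝ)) :=
      (Complex.continuous_ofReal.tendsto _).comp (hkθ.mul_const _)
    convert hrem.sub hsq using 2 with x
    · push_cast
      ring
    · push_cast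
      ring
  simpa using tendsto_one_add_pow_exp hφ hmain

end CharFunPow

section Boxes

variable {d : ℕ} {x y : Fin d → ℕ}

theorem boxVolume_pos (hx : ∀ i, 0 < x i) : 0 < boxVolume x :=
  Finset.prod_pos fun i _ => hx i

theorem pos_of_boxVolume_pos (hx : 0 < boxVolume x) (i : Fin d) : 0 < x i :=
  Nat.pos_of_ne_zero fun h0 => hx.ne' (Finset.prod_eq_zero (Finset.mem_univ i) h0)

/-- The boxes of large volume. -/
def largeBoxes (d : ℕ) : Filter (Fin d → ℕ) := comap boxVolume atTop

instance : (largeBoxes d).IsCountablyGenerated :=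
  inferInstanceAs (comap boxVolume atTop).IsCountablyGenerated

theorem tendsto_boxVolume_largeBoxes :
    Tendsto (fun x : Fin d → ℕ => (boxVolume x : ℝ)) (largeBoxes d) atTop :=
  tendsto_natCast_atTop_atTop.comp tendsto_comap

theorem eventually_boxVolume_pos_largeBoxes : ∀ᶠ x in largeBoxes d, 0 < boxVolume x :=
  tendsto_comap.eventually_gt_atTop 0

/-- The indices of the translates of `box y` that fit into `box x`, aligned at the corner. -/
def blockIndex (x y : Fin d → ℕ) : Finset (Fin d → ℕ) :=
  Fintype.piFinset fun i => Finset.range (x i / y i)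

/-- The translation taking `box y` to its translate of index `a`. -/
def blockShift (y a : Fin d → ℕ) : Fin d → ℤ := fun i => (a i : ℤ) * y i

/-- The part of `box x` covered by the translates of `box y` that fit into it. -/
noncomputable def blockUnion (x y : Fin d → ℕ) : Finset (Fin d → ℤ) :=
  (blockIndex x y ×ˢ box y).image fun p => p.2 + blockShift y p.1

theorem injOn_add_blockShift (x y : Fin d → ℕ) :
    Set.InjOn (fun p : (Fin d → ℕ) × (Fin d → ℤ) => p.2 + blockShift y p.1)
      (blockIndex x y ×ˢ box y : Finset _) := by
  rintro ⟨a, u⟩ hp ⟨b, v⟩ hq h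
  simp only [Finset.coe_product, Set.mem_prod, Finset.mem_coe, box, Fintype.mem_piFinset,
    Finset.mem_Icc] at hp hq
  have hab : a = b := funext fun i => by
    have hi : u i + a i * y i = v i + b i * y i := congrFun h i
    have hu := hp.2 i
    have hv := hq.2 i
    rcases lt_trichotomy (a i) (b i) with hlt | heq | hlt
    · have : (a i : ℤ) + 1 ≤ b i := by exact_mod_cast hlt
      nlinarith
    · exact heq
    · have : (b i : ℤ) + 1 ≤ a i := by exact_mod_cast hlt
      nlinarith
  subst hab
  simpa using h

theorem blockUnion_subset_box (x y : Fin d → ℕ) : blockUnion x y ⊆ box x := by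
  refine Finset.image_subset_iff.2 fun ⟨a, u⟩ hp => ?_
  simp only [Finset.mem_product, box, blockIndex, Fintype.mem_piFinset, Finset.mem_Icc,
    Finset.mem_range] at hp ⊢
  intro i
  have hu := hp.2 i
  have hax : ((a i : ℤ) + 1) * y i ≤ x i := by
    exact_mod_cast (Nat.mul_le_mul_right _ (hp.1 i)).trans (Nat.div_mul_le_self _ _)
  have ha : (0 : ℤ) ≤ a i * y i := by positivity
  simp only [Pi.add_apply, blockShift]
  constructor <;> linarith

theorem tendsto_nat_div_div_self {m : ℕ} :
    Tendsto (fun n : ℕ => ((n / m : ℕ) : ℝ) / n) atTop (𝓝 (1 / m)) := by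
  refine ((tendsto_nat_floor_mul_div_atTop (R := ℝ) (a := 1 / m) (by positivity)).comp
    tendsto_natCast_atTop_atTop).congr fun n => ?_
  simp only [Function.comp]
  rw [one_div_mul_eq_div, Nat.floor_div_natCast, Nat.floor_natCast]

theorem tendsto_card_blockIndex_div {l : Filter (Fin d → ℕ)} (hy : ∀ i, 0 < y i)
    (hl : ∀ i, Tendsto (fun x : Fin d → ℕ => x i) l atTop ∨ ∀ᶠ x in l, x i = y i) :
    Tendsto (fun x => ((blockIndex x y).card : ℝ) / boxVolume x) l (𝓝 (1 / boxVolume y)) := by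
  have hside : ∀ i ∈ Finset.univ, Tendsto (fun x : Fin d → ℕ => ((x i / y i : ℕ) : ℝ) / x i) l
      (𝓝 (1 / y i)) := by
    intro i _
    rcases hl i with h | h
    · exact tendsto_nat_div_div_self.comp h
    · refine tendsto_const_nhds.congr' ?_
      filter_upwards [h] with x hx
      rw [hx, Nat.div_self (hy i), Nat.cast_one]
  simpa [blockIndex, boxVolume, Finset.prod_div_distrib] using tendsto_finsetProd _ hside

theorem tendsto_atTop_or_eventually_eq {α : Type*} (U : Ultrafilter α) (f : α → ℕ) :
    Tendsto f U atTop ∨ ∃ c, ∀ᶠ x in U, f x = c := by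
  rcases (U.map f).le_cofinite_or_eq_pure with h | ⟨c, h⟩
  · rw [← Nat.cofinite_eq_atTop]
    exact Or.inl h
  · have hc : {c} ∈ U.map f := by rw [h]; exact Set.mem_singleton c
    exact Or.inr ⟨c, hc⟩

theorem eventually_forall_tendsto_atTop_or_eventually_eq (U : Ultrafilter (Fin d → ℕ)) :
    ∀ᶠ y in (U : Filter (Fin d → ℕ)), ∀ i, Tendsto (fun x : Fin d → ℕ => x i) U atTop ∨
      ∀ᶠ x in (U : Filter (Fin d → ℕ)), x i = y i := by
  refine eventually_all.2 fun i => ?_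
  rcases tendsto_atTop_or_eventually_eq U (fun x => x i) with h | ⟨c, hc⟩
  · exact Eventually.of_forall fun _ => Or.inl h
  · filter_upwards [hc] with y hy
    rw [hy]
    exact Or.inr hc

end Boxes

section Field

variable {d : ℕ} {Ω : Type*}

/-- The sum of the field `X` over a box. -/
noncomputable def boxSum (X : (Fin d → ℤ) → Ω → ℝ) (x : Fin d → ℕ) (ω : Ω) : ℝ :=
  ∑ u ∈ box x, X u ω

/-- The sum of the field `X` over a box, normalised by the square root of the volume; its variance
is the variance per site of `X` in the box. -/
noncomputable def normSum (X : (Fin d → ℤ) → Ω → ℝ) (x : Fin d → ℕ) (ω : Ω) : ℝ :=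
  (√(boxVolume x))⁻¹ * boxSum X x ω

/-- A stationary, centred, square integrable FKG field of finite susceptibility. -/
structure IsFKGSystem [MeasurableSpace Ω] (X : (Fin d → ℤ) → Ω → ℝ) (P : Measure Ω) : Prop where
  measurable : ∀ u, Measurable (X u)
  stationary : IsStationary X P
  memLp : ∀ u, MemLp (X u) 2 P
  integral_eq_zero : ∀ u, ∫ ω, X u ω ∂P = 0
  fkg : IsFKG X P
  summable_cov : Summable fun u => cov[X 0, X u; P]

variable {X : (Fin d → ℤ) → Ω → ℝ}

theorem boxSum_eq_sum_blocks_add (x y : Fin d → ℕ) :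
    boxSum X x = fun ω => ∑ a ∈ blockIndex x y, ∑ u ∈ box y, X (u + blockShift y a) ω +
      ∑ u ∈ box x \ blockUnion x y, X u ω := by
  ext ω
  rw [boxSum, ← Finset.sum_sdiff (blockUnion_subset_box x y), add_comm, blockUnion,
    Finset.sum_image (injOn_add_blockShift x y), Finset.sum_product]

variable [MeasurableSpace Ω] {P : Measure Ω}

theorem variance_normSum (x : Fin d → ℕ) :
    Var[normSum X x; P] = Var[boxSum X x; P] / boxVolume x := by
  rw [show normSum X x = fun ω => (√(boxVolume x))⁻¹ * boxSum X x ω from rfl, variance_const_mul,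
    inv_pow, Real.sq_sqrt (Nat.cast_nonneg _), inv_mul_eq_div]

namespace IsFKGSystem

variable (h : IsFKGSystem X P)
include h

theorem memLp_sum (T : Finset (Fin d → ℤ)) : MemLp (fun ω => ∑ u ∈ T, X u ω) 2 P :=
  memLp_finsetSum T fun u _ => h.memLp u

theorem memLp_boxSum (x : Fin d → ℕ) : MemLp (boxSum X x) 2 P := h.memLp_sum _

theorem memLp_normSum (x : Fin d → ℕ) : MemLp (normSum X x) 2 P :=
  (h.memLp_boxSum x).const_mul _

theorem measurable_normSum (x : Fin d → ℕ) : Measurable (normSum X x) :=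
  (Finset.measurable_fun_sum _ fun u _ => h.measurable u).const_mul _

theorem identDistrib_add (a : Fin d → ℤ) :
    IdentDistrib (fun ω u => X (u + a) ω) (fun ω u => X u ω) P P :=
  ⟨(measurable_pi_lambda _ fun _ => h.measurable _).aemeasurable,
    (measurable_pi_lambda _ h.measurable).aemeasurable, h.stationary a⟩

theorem identDistrib_boxSum (y : Fin d → ℕ) (a : Fin d → ℤ) :
    IdentDistrib (fun ω => ∑ u ∈ box y, X (u + a) ω) (boxSum X y) P P :=
  (h.identDistrib_add a).comp (u := fun z : (Fin d → ℤ) → ℝ => ∑ u ∈ box y, z u) (by fun_prop)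

theorem cov_eq_cov_zero (u v : Fin d → ℤ) : cov[X u, X v; P] = cov[X 0, X (v - u); P] := by
  have cov_map : ∀ {Y : Ω → (Fin d → ℤ) → ℝ}, AEMeasurable Y P →
      cov[fun z => z 0, fun z => z (v - u); P.map Y] =
        cov[fun ω => Y ω 0, fun ω => Y ω (v - u); P] := fun hY =>
    covariance_map_fun (measurable_pi_apply _).aestronglyMeasurable
      (measurable_pi_apply _).aestronglyMeasurable hY
  have hid := h.identDistrib_add u
  simpa [cov_map hid.aemeasurable_fst, cov_map hid.aemeasurable_snd] using
    congrArg (fun μ => cov[fun z => z 0, fun z => z (v - u); μ]) hid.map_eq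

theorem cov_nonneg (u v : Fin d → ℤ) : 0 ≤ cov[X u, X v; P] :=
  h.fkg.cov_nonneg (isIncreasing_apply u) (isIncreasing_apply v) (h.memLp u) (h.memLp v)

theorem charFun_normSum (x : Fin d → ℕ) (t : ℝ) :
    charFun (P.map (normSum X x)) t = charFun (P.map (boxSum X x)) ((√(boxVolume x))⁻¹ * t) :=
  charFun_map_mul_eq (h.memLp_boxSum x).aemeasurable

variable [IsProbabilityMeasure P]

theorem integral_sum (T : Finset (Fin d → ℤ)) : ∫ ω, ∑ u ∈ T, X u ω ∂P = 0 := by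
  rw [integral_finsetSum _ fun u _ => (h.memLp u).integrable one_le_two]
  exact Finset.sum_eq_zero fun u _ => h.integral_eq_zero u

theorem integral_normSum (x : Fin d → ℕ) : ∫ ω, normSum X x ω ∂P = 0 := by
  simp_rw [normSum, integral_const_mul]
  rw [show ∫ ω, boxSum X x ω ∂P = 0 from h.integral_sum _, mul_zero]

theorem variance_boxSum_le (x : Fin d → ℕ) :
    Var[boxSum X x; P] ≤ boxVolume x * ∑' u, cov[X 0, X u; P] := by
  have hvar : Var[boxSum X x; P] = ∑ u ∈ box x, ∑ v ∈ box x, cov[X u, X v; P] :=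
    variance_fun_sum' fun u _ => h.memLp u
  rw [hvar, ← card_box, ← nsmul_eq_mul]
  refine Finset.sum_le_card_nsmul _ _ _ fun u _ => ?_
  simp_rw [h.cov_eq_cov_zero u]
  have hsum := (Equiv.subRight u).summable_iff.2 h.summable_cov
  exact (hsum.sum_le_tsum _ fun v _ => h.cov_nonneg _ _).trans_eq
    ((Equiv.subRight u).tsum_eq fun v => cov[X 0, X v; P])

theorem variance_normSum_le (x : Fin d → ℕ) :
    Var[normSum X x; P] ≤ ∑' u, cov[X 0, X u; P] := by
  rw [variance_normSum]
  exact div_le_of_le_mul₀ (Nat.cast_nonneg _) (tsum_nonneg fun _ => h.cov_nonneg _ _)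
    ((h.variance_boxSum_le x).trans_eq (mul_comm _ _))

theorem norm_charFun_boxSum_sub_pow_le (x y : Fin d → ℕ) (t : ℝ) :
    ‖charFun (P.map (boxSum X x)) t - charFun (P.map (boxSum X y)) t ^ (blockIndex x y).card‖ ≤
      |t| * √(Var[boxSum X x; P] - (blockIndex x y).card * Var[boxSum X y; P]) +
        2 * t ^ 2 * (Var[boxSum X x; P] - (blockIndex x y).card * Var[boxSum X y; P]) := by
  have hle := h.fkg.norm_charFun_sum_add_sub_prod_le (blockIndex x y)
    (fun a => isIncreasing_sum (box y) fun u => isIncreasing_apply (u + blockShift y a))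
    (fun a => memLp_finsetSum _ fun u _ => h.memLp _)
    (isIncreasing_sum (box x \ blockUnion x y) isIncreasing_apply) (h.memLp_sum _)
    (h.integral_sum _) rfl t
  simpa only [← boxSum_eq_sum_blocks_add, (h.identDistrib_boxSum y _).variance_eq,
    (h.identDistrib_boxSum y _).map_eq, Finset.sum_const, Finset.prod_const, nsmul_eq_mul] using hle

theorem norm_charFun_normSum_sub_pow_le (x y : Fin d → ℕ) (t : ℝ) {D : ℝ}
    (hD : Var[normSum X x; P] - (blockIndex x y).card / boxVolume x * Var[boxSum X y; P] = D) :
    ‖charFun (P.map (normSum X x)) t -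
        charFun (P.map (boxSum X y)) ((√(boxVolume x))⁻¹ * t) ^ (blockIndex x y).card‖ ≤
      |t| * √D + 2 * t ^ 2 * D := by
  have hV := Real.sq_sqrt (Nat.cast_nonneg (α := ℝ) (boxVolume x))
  have hD' : D = (Var[boxSum X x; P] - (blockIndex x y).card * Var[boxSum X y; P]) /
      boxVolume x := by
    rw [← hD, variance_normSum]
    ring
  rw [h.charFun_normSum]
  refine (h.norm_charFun_boxSum_sub_pow_le x y _).trans_eq ?_
  rw [hD', Real.sqrt_div' _ (Nat.cast_nonneg _), abs_mul, abs_of_nonneg (by positivity), mul_pow,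
    inv_pow, hV]
  ring

theorem tendsto_charFun_boxSum_pow {l : Filter (Fin d → ℕ)} (hl : l ≤ largeBoxes d)
    {y : Fin d → ℕ} (hy : ∀ i, 0 < y i)
    (hly : ∀ i, Tendsto (fun x : Fin d → ℕ => x i) l atTop ∨ ∀ᶠ x in l, x i = y i) (t : ℝ) :
    Tendsto (fun x => charFun (P.map (boxSum X y)) ((√(boxVolume x))⁻¹ * t) ^
      (blockIndex x y).card) l (𝓝 (Complex.exp (-(t ^ 2 * Var[normSum X y; P] / 2 : ℝ)))) := by
  have hθ : Tendsto (fun x : Fin d → ℕ => (√(boxVolume x))⁻¹ * t) l (𝓝 0) := by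
    simpa using ((Real.tendsto_sqrt_atTop.comp
      (tendsto_boxVolume_largeBoxes.mono_left hl)).inv_tendsto_atTop).mul_const t
  have hkθ : Tendsto (fun x => (blockIndex x y).card * ((√(boxVolume x))⁻¹ * t) ^ 2) l
      (𝓝 (t ^ 2 / boxVolume y)) := by
    convert (tendsto_card_blockIndex_div hy hly).mul_const (t ^ 2) using 2 with x
    · rw [mul_pow, inv_pow, Real.sq_sqrt (Nat.cast_nonneg _)]
      ring
    · ring
  convert tendsto_charFun_pow (h.memLp_boxSum y) (h.integral_sum _) hθ hkθ using 5
  rw [variance_normSum]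
  ring

end IsFKGSystem

/-- The asymptotic error at frequency `t` in approximating a field of variance `s` per site by
independent blocks of variance `r` per site. -/
noncomputable def blockError (t s r : ℝ) : ℝ :=
  |t| * √(s - r) + 2 * t ^ 2 * (s - r) +
    ‖Complex.exp (-(t ^ 2 * r / 2 : ℝ)) - Complex.exp (-(t ^ 2 * s / 2 : ℝ))‖

theorem tendsto_blockError (t s : ℝ) : Tendsto (blockError t s) (𝓝 s) (𝓝 0) := by
  have hc : Continuous (blockError t s) := by unfold blockError; fun_prop
  simpa [blockError] using hc.tendsto s

namespace IsFKGSystem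

variable (h : IsFKGSystem X P) [IsProbabilityMeasure P] {l : Filter (Fin d → ℕ)}
  (hl : l ≤ largeBoxes d) {s : ℝ} (hs : Tendsto (fun x => Var[normSum X x; P]) l (𝓝 s))
include h hl hs

theorem eventually_norm_charFun_normSum_sub_lt {y : Fin d → ℕ} (hy : ∀ i, 0 < y i)
    (hly : ∀ i, Tendsto (fun x : Fin d → ℕ => x i) l atTop ∨ ∀ᶠ x in l, x i = y i) {t ε : ℝ}
    (hε : blockError t s Var[normSum X y; P] < ε) :
    ∀ᶠ x in l, ‖charFun (P.map (normSum X x)) t - Complex.exp (-(t ^ 2 * s / 2 : ℝ))‖ < ε := by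
  set D : (Fin d → ℕ) → ℝ := fun x =>
    Var[normSum X x; P] - (blockIndex x y).card / boxVolume x * Var[boxSum X y; P]
  have hD : Tendsto D l (𝓝 (s - Var[normSum X y; P])) := by
    rw [variance_normSum, ← one_div_mul_eq_div]
    exact hs.sub ((tendsto_card_blockIndex_div hy hly).mul_const _)
  have hlim : Tendsto (fun x => |t| * √(D x) + 2 * t ^ 2 * D x +
      ‖charFun (P.map (boxSum X y)) ((√(boxVolume x))⁻¹ * t) ^ (blockIndex x y).card
        - Complex.exp (-(t ^ 2 * s / 2 : ℝ))‖) l (𝓝 (blockError t s Var[normSum X y; P])) :=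
    ((hD.sqrt.const_mul _).add (hD.const_mul _)).add
      ((h.tendsto_charFun_boxSum_pow hl hy hly t).sub_const _).norm
  filter_upwards [hlim.eventually_lt_const hε] with x hx
  refine (norm_sub_le_norm_sub_add_norm_sub _ (charFun (P.map (boxSum X y))
    ((√(boxVolume x))⁻¹ * t) ^ (blockIndex x y).card) _).trans_lt (lt_of_le_of_lt ?_ hx)
  gcongr
  exact h.norm_charFun_normSum_sub_pow_le x y t rfl

/-- **Newman's central limit theorem** along boxes of growing volume and arbitrary shape. -/
theorem tendsto_charFun_normSum (t : ℝ) :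
    Tendsto (fun x => charFun (P.map (normSum X x)) t) l
      (𝓝 (Complex.exp (-(t ^ 2 * s / 2 : ℝ)))) := by
  -- Along an ultrafilter every side length is eventually constant or tends to infinity, so that a
  -- typical box of the ultrafilter tiles all later ones up to a negligible proportion.
  refine tendsto_iff_ultrafilter _ _ _ |>.2 fun U hU => ?_
  rw [Metric.tendsto_nhds]
  intro ε hε
  obtain ⟨y, hyε, hyU, hy⟩ := (((tendsto_blockError t s).comp (hs.mono_left hU)
    |>.eventually_lt_const hε).and ((eventually_forall_tendsto_atTop_or_eventually_eq U).and
      ((hU.trans hl) eventually_boxVolume_pos_largeBoxes))).exists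
  simp_rw [dist_eq_norm]
  exact h.eventually_norm_charFun_normSum_sub_lt (hU.trans hl) (hs.mono_left hU)
    (pos_of_boxVolume_pos hy) hyU hyε

end IsFKGSystem

end Field

section FisherInformation

theorem IsSmoothDensity.unique {f g : ℝ → ℝ} {μ : Measure ℝ} [IsFiniteMeasure μ]
    (hf : IsSmoothDensity f μ) (hg : IsSmoothDensity g μ) : f = g := by
  have hfin : ∫⁻ x, ENNReal.ofReal (f x) ≠ ∞ := by
    rw [← setLIntegral_univ, ← withDensity_apply _ MeasurableSet.univ, ← hf.eq_withDensity]
    exact measure_ne_top _ _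
  have hae := (withDensity_eq_iff hf.contDiff.continuous.measurable.ennreal_ofReal.aemeasurable
    hg.contDiff.continuous.measurable.ennreal_ofReal.aemeasurable hfin).1
    (hf.eq_withDensity.symm.trans hg.eq_withDensity)
  refine (hf.contDiff.continuous.ae_eq_iff_eq volume hg.contDiff.continuous).1 ?_
  filter_upwards [hae] with x hx
  exact (ENNReal.ofReal_eq_ofReal_iff (hf.nonneg x) (hg.nonneg x)).1 hx

theorem measurable_score {f : ℝ → ℝ} (hf : Measurable f) : Measurable (score f) :=
  (measurable_deriv f).div hf

theorem fisherInfo_id_map {Ω : Type*} [MeasurableSpace Ω] {P : Measure Ω} {U : Ω → ℝ}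
    (hU : AEMeasurable U P) : fisherInfo id (P.map U) = fisherInfo U P := by
  unfold fisherInfo
  refine iInf_congr fun f => ?_
  rw [Measure.map_id]
  refine iInf_congr fun hf => ?_
  exact lintegral_map' (((measurable_score hf.contDiff.continuous.measurable).pow_const
    2).ennreal_ofReal.aemeasurable) hU

theorem IsSmoothDensity.fisherInfo_id_eq {f : ℝ → ℝ} {μ : Measure ℝ} [IsFiniteMeasure μ]
    (hf : IsSmoothDensity f μ) :
    fisherInfo id μ = ∫⁻ v, ENNReal.ofReal (deriv f v ^ 2 / f v) := by
  have hfm := hf.contDiff.continuous.measurable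
  have hμ : IsSmoothDensity f (μ.map id) := by rwa [Measure.map_id]
  have : fisherInfo id μ = ∫⁻ v, ENNReal.ofReal (score f v ^ 2) ∂μ :=
    le_antisymm (iInf₂_le f hμ) (le_iInf₂ fun g hg => by rw [hg.unique hμ]; rfl)
  rw [this, hf.eq_withDensity, lintegral_withDensity_eq_lintegral_mul _ hfm.ennreal_ofReal
    ((measurable_score hfm).pow_const 2).ennreal_ofReal]
  refine lintegral_congr fun v => ?_
  rw [Pi.mul_apply, ← ENNReal.ofReal_mul (hf.nonneg v), score]
  rcases eq_or_ne (f v) 0 with h0 | h0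
  · simp [h0]
  · field_simp

theorem tendsto_lintegral_of_le_of_tendsto {α ι : Type*} [MeasurableSpace α] {μ : Measure α}
    {l : Filter ι} [l.IsCountablyGenerated] {h g : ι → α → ℝ≥0∞} {h' g' : α → ℝ≥0∞}
    (hm : ∀ i, Measurable (h i)) (gm : ∀ i, Measurable (g i)) (gm' : Measurable g')
    (hle : ∀ i x, h i x ≤ g i x) (hle' : ∀ x, h' x ≤ g' x)
    (hlim : ∀ x, Tendsto (fun i => h i x) l (𝓝 (h' x)))
    (glim : ∀ x, Tendsto (fun i => g i x) l (𝓝 (g' x))) (gfin : ∫⁻ x, g' x ∂μ ≠ ∞)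
    (gint : Tendsto (fun i => ∫⁻ x, g i x ∂μ) l (𝓝 (∫⁻ x, g' x ∂μ))) :
    Tendsto (fun i => ∫⁻ x, h i x ∂μ) l (𝓝 (∫⁻ x, h' x ∂μ)) := by
  have tendsto_min : ∀ {k : ι → α → ℝ≥0∞} {k' : α → ℝ≥0∞}, (∀ i, Measurable (k i)) →
      (∀ x, k' x ≤ g' x) → (∀ x, Tendsto (fun i => k i x) l (𝓝 (k' x))) →
      Tendsto (fun i => ∫⁻ x, min (k i x) (g' x) ∂μ) l (𝓝 (∫⁻ x, k' x ∂μ)) :=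
    fun {k k'} km kle klim => tendsto_lintegral_filter_of_dominated_convergence g'
      (Eventually.of_forall fun i => (km i).min gm')
      (Eventually.of_forall fun i => ae_of_all _ fun x => min_le_right _ _) gfin
      (ae_of_all _ fun x => by
        simpa only [min_eq_left (kle x)] using (klim x).min (tendsto_const_nhds (x := g' x)))
  have hexcess : Tendsto (fun i => ∫⁻ x, (g i x - min (g i x) (g' x)) ∂μ) l (𝓝 0) := by
    rw [← tsub_self (∫⁻ x, g' x ∂μ)]
    refine (ENNReal.Tendsto.sub gint (tendsto_min gm (fun _ => le_rfl) glim) (.inl gfin)).congr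
      fun i => (lintegral_sub ((gm i).min gm') ?_ (ae_of_all _ fun x => min_le_left _ _)).symm
    exact ne_top_of_le_ne_top gfin (lintegral_mono fun x => min_le_right _ _)
  have hmin := tendsto_min hm hle' hlim
  refine tendsto_of_tendsto_of_tendsto_of_le_of_le hmin (by simpa using hmin.add hexcess)
    (fun i => lintegral_mono fun x => min_le_left _ _) fun i => ?_
  simp only
  rw [← lintegral_add_left ((hm i).min gm')]
  refine lintegral_mono fun x => ?_
  rcases le_total (g i x) (g' x) with hg | hg
  · simp [min_eq_left ((hle i x).trans hg)]
  · rcases le_total (h i x) (g' x) with hh | hh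
    · simp [min_eq_left hh]
    · simpa only [min_eq_right hh, min_eq_right hg, add_tsub_cancel_of_le hg] using hle i x

end FisherInformation

section Mixture

/-- The mixture of the translates of a bounded continuous kernel `k` under a law `μ`, that is, the
convolution of `k` with `μ`. -/
noncomputable def mixture (k : BoundedContinuousFunction ℝ ℝ) (μ : Measure ℝ) (v : ℝ) : ℝ :=
  ∫ y, k (v - y) ∂μ

variable {μ : Measure ℝ} {k : BoundedContinuousFunction ℝ ℝ}

theorem integrable_translate [IsFiniteMeasure μ] (k : BoundedContinuousFunction ℝ ℝ) (v : ℝ) :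
    Integrable (fun y => k (v - y)) μ :=
  Integrable.of_bound (by fun_prop) ‖k‖ (ae_of_all _ fun _ => k.norm_coe_le_norm _)

theorem continuous_mixture [IsFiniteMeasure μ] (k : BoundedContinuousFunction ℝ ℝ) :
    Continuous (mixture k μ) :=
  continuous_of_dominated (bound := fun _ => ‖k‖) (fun v => by fun_prop)
    (fun v => ae_of_all _ fun y => k.norm_coe_le_norm _) (integrable_const _)
    (ae_of_all _ fun y => by fun_prop)

theorem ofReal_mixture [IsFiniteMeasure μ] (hk : ∀ z, 0 ≤ k z) (v : ℝ) :
    ENNReal.ofReal (mixture k μ v) = ∫⁻ y, ENNReal.ofReal (k (v - y)) ∂μ :=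
  ofReal_integral_eq_lintegral_ofReal (integrable_translate k v) (ae_of_all _ fun _ => hk _)

theorem withDensity_mixture [IsFiniteMeasure μ] (hk : ∀ z, 0 ≤ k z) :
    volume.withDensity (fun v => ENNReal.ofReal (mixture k μ v)) =
      μ ∗ volume.withDensity fun z => ENNReal.ofReal (k z) := by
  ext s hs
  have hms : Measurable (s.indicator (1 : ℝ → ℝ≥0∞)) := measurable_one.indicator hs
  rw [withDensity_apply _ hs, ← lintegral_indicator_one hs, Measure.lintegral_conv hms]
  simp_rw [ofReal_mixture hk]
  rw [lintegral_lintegral_swap (by fun_prop)]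
  refine lintegral_congr fun y => ?_
  rw [lintegral_withDensity_eq_lintegral_mul _ (by fun_prop) (g := fun z => s.indicator 1 (y + z))
      (hms.comp (measurable_const_add y)),
    ← lintegral_indicator hs, ← lintegral_add_left_eq_self _ y]
  refine lintegral_congr fun z => ?_
  by_cases hz : y + z ∈ s <;> simp [hz]

theorem lintegral_mixture [IsProbabilityMeasure μ] (hk : ∀ z, 0 ≤ k z) :
    ∫⁻ v, ENNReal.ofReal (mixture k μ v) = ∫⁻ z, ENNReal.ofReal (k z) := by
  simp_rw [ofReal_mixture hk]
  rw [lintegral_lintegral_swap (by fun_prop)]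
  simp_rw [lintegral_sub_right_eq_self fun z => ENNReal.ofReal (k z)]
  simp

theorem tendsto_mixture {ι : Type*} {l : Filter ι} {μs : ι → ProbabilityMeasure ℝ}
    {ν : ProbabilityMeasure ℝ} (h : Tendsto μs l (𝓝 ν)) (k : BoundedContinuousFunction ℝ ℝ)
    (v : ℝ) :
    Tendsto (fun i => mixture k (μs i) v) l (𝓝 (mixture k ν v)) :=
  ProbabilityMeasure.tendsto_iff_forall_integral_tendsto.1 h
    (k.compContinuous ⟨fun y => v - y, by fun_prop⟩)

theorem hasDerivAt_mixture [IsFiniteMeasure μ] {k' : BoundedContinuousFunction ℝ ℝ}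
    (hk : ∀ z, HasDerivAt k (k' z) z) (v : ℝ) : HasDerivAt (mixture k μ) (mixture k' μ v) v :=
  (hasDerivAt_integral_of_dominated_loc_of_deriv_le (μ := μ) (s := Set.univ)
    (F := fun v y => k (v - y)) (F' := fun v y => k' (v - y)) (bound := fun _ => ‖k'‖) univ_mem
    (Eventually.of_forall fun x => by fun_prop) (integrable_translate k v) (by fun_prop)
    (ae_of_all _ fun y x _ => k'.norm_coe_le_norm _) (integrable_const _)
    (ae_of_all _ fun y x _ => (hk (x - y)).comp_sub_const x y)).2

theorem mixture_pos [IsFiniteMeasure μ] [NeZero μ] (hk : ∀ z, 0 < k z) (v : ℝ) :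
    0 < mixture k μ v := by
  have hsupp : Function.support (fun y => k (v - y)) = Set.univ :=
    Set.eq_univ_of_forall fun y => (hk _).ne'
  refine (integral_pos_iff_support_of_nonneg (fun y => (hk _).le) (integrable_translate k v)).2 ?_
  rw [hsupp]
  exact Measure.measure_univ_pos.2 (NeZero.ne μ)

theorem isSmoothDensity_mixture [IsFiniteMeasure μ] {k' : BoundedContinuousFunction ℝ ℝ}
    (hk : ∀ z, HasDerivAt k (k' z) z) (hk0 : ∀ z, 0 ≤ k z) :
    IsSmoothDensity (mixture k μ) (μ ∗ volume.withDensity fun z => ENNReal.ofReal (k z)) where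
  contDiff := by
    refine contDiff_one_iff_deriv.2 ⟨fun v => (hasDerivAt_mixture hk v).differentiableAt, ?_⟩
    rw [show deriv (mixture k μ) = mixture k' μ from
      funext fun v => (hasDerivAt_mixture hk v).deriv]
    exact continuous_mixture k'
  nonneg v := integral_nonneg fun y => hk0 _
  eq_withDensity := (withDensity_mixture hk0).symm

/-- The Cauchy–Schwarz inequality for the densities `k`, `k'` and `k'² / k`. -/
theorem sq_mixture_div_le [IsFiniteMeasure μ] [NeZero μ] {k' q : BoundedContinuousFunction ℝ ℝ}
    (hk : ∀ z, 0 < k z) (hq : ∀ z, k z * q z = k' z ^ 2) (v : ℝ) :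
    mixture k' μ v ^ 2 / mixture k μ v ≤ mixture q μ v := by
  set c := mixture k' μ v / mixture k μ v with hc
  have hpos := mixture_pos (μ := μ) hk v
  have hnonneg : 0 ≤ ∫ y, (q (v - y) - 2 * c * k' (v - y) + c ^ 2 * k (v - y)) ∂μ := by
    refine integral_nonneg fun y => ?_
    refine nonneg_of_mul_nonneg_right ?_ (hk (v - y))
    calc (0 : ℝ) ≤ (k' (v - y) - c * k (v - y)) ^ 2 := sq_nonneg _
      _ = _ := by linear_combination -(hq (v - y))
  have hint : Integrable (fun y => q (v - y) - 2 * c * k' (v - y)) μ :=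
    (integrable_translate q v).sub ((integrable_translate k' v).const_mul _)
  rw [integral_add hint ((integrable_translate k v).const_mul _),
    integral_sub (integrable_translate q v) ((integrable_translate k' v).const_mul _),
    integral_const_mul, integral_const_mul] at hnonneg
  change 0 ≤ mixture q μ v - 2 * c * mixture k' μ v + c ^ 2 * mixture k μ v at hnonneg
  have hcc : 2 * c * mixture k' μ v - c ^ 2 * mixture k μ v =
      mixture k' μ v ^ 2 / mixture k μ v := by
    rw [hc]
    field_simp
    ring
  linarith

/-- `q` is the density `k'² / k` of the Fisher information of the kernel `k`. -/
theorem tendsto_fisherInfo_conv {ι : Type*} {l : Filter ι} [l.IsCountablyGenerated]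
    {k' q : BoundedContinuousFunction ℝ ℝ} (hk' : ∀ z, HasDerivAt k (k' z) z)
    (hk : ∀ z, 0 < k z) (hq : ∀ z, k z * q z = k' z ^ 2)
    (hqfin : ∫⁻ z, ENNReal.ofReal (q z) ≠ ∞) {μs : ι → ProbabilityMeasure ℝ}
    {ν : ProbabilityMeasure ℝ} (h : Tendsto μs l (𝓝 ν))
    [IsFiniteMeasure (volume.withDensity fun z => ENNReal.ofReal (k z))] :
    Tendsto (fun i => fisherInfo id
        ((μs i : Measure ℝ) ∗ volume.withDensity fun z => ENNReal.ofReal (k z))) l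
      (𝓝 (fisherInfo id ((ν : Measure ℝ) ∗ volume.withDensity fun z => ENNReal.ofReal (k z)))) := by
  have hq0 : ∀ z, 0 ≤ q z := fun z =>
    nonneg_of_mul_nonneg_right ((hq z).symm ▸ sq_nonneg (k' z)) (hk z)
  have hcont : ∀ (κ : BoundedContinuousFunction ℝ ℝ) (μ : ProbabilityMeasure ℝ),
      Measurable (mixture κ μ) := fun κ _ => (continuous_mixture κ).measurable
  have hfisher : ∀ μ : ProbabilityMeasure ℝ,
      fisherInfo id ((μ : Measure ℝ) ∗ volume.withDensity fun z => ENNReal.ofReal (k z)) =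
        ∫⁻ v, ENNReal.ofReal (mixture k' μ v ^ 2 / mixture k μ v) := fun μ => by
    rw [(isSmoothDensity_mixture hk' fun z => (hk z).le).fisherInfo_id_eq]
    simp_rw [(hasDerivAt_mixture hk' _).deriv]
  have hqint : ∀ μ : ProbabilityMeasure ℝ, ∫⁻ v, ENNReal.ofReal (mixture q μ v) =
      ∫⁻ z, ENNReal.ofReal (q z) := fun μ => lintegral_mixture hq0
  simp_rw [hfisher]
  refine tendsto_lintegral_of_le_of_tendsto
    (fun i => (((hcont k' _).pow_const 2).div (hcont k _)).ennreal_ofReal)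
    (fun i => (hcont q _).ennreal_ofReal) (hcont q ν).ennreal_ofReal
    (fun i v => ENNReal.ofReal_le_ofReal (sq_mixture_div_le hk hq v))
    (fun v => ENNReal.ofReal_le_ofReal (sq_mixture_div_le hk hq v))
    (fun v => (ENNReal.continuous_ofReal.tendsto _).comp
      (((tendsto_mixture h k' v).pow 2).div (tendsto_mixture h k v) (mixture_pos hk v).ne'))
    (fun v => (ENNReal.continuous_ofReal.tendsto _).comp (tendsto_mixture h q v))
    (by rwa [hqint]) ?_
  simp_rw [hqint]
  exact tendsto_const_nhds

end Mixture

section Gaussian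

theorem hasDerivAt_gaussianPDFReal (v : ℝ≥0) (z : ℝ) :
    HasDerivAt (gaussianPDFReal 0 v) (-(z / v) * gaussianPDFReal 0 v z) z := by
  have hexp : HasDerivAt (fun z : ℝ => -(z - 0) ^ 2 / (2 * v)) (-(z / v)) z := by
    refine ((((hasDerivAt_id' z).sub_const 0).fun_pow 2).fun_neg.div_const
      (2 * (v : ℝ))).congr_deriv ?_
    rw [Nat.cast_ofNat, sub_zero, mul_one, pow_one, neg_div, mul_div_mul_left _ _ two_ne_zero]
  refine (hexp.exp.const_mul (√(2 * Real.pi * v))⁻¹).congr_deriv ?_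
  rw [gaussianPDFReal]
  ring

theorem continuous_gaussianPDFReal (m : ℝ) (v : ℝ≥0) : Continuous (gaussianPDFReal m v) := by
  rw [gaussianPDFReal_def]
  fun_prop

theorem gaussianPDFReal_le (m : ℝ) (v : ℝ≥0) (z : ℝ) :
    gaussianPDFReal m v z ≤ (√(2 * Real.pi * v))⁻¹ := by
  refine mul_le_of_le_one_right (by positivity) (Real.exp_le_one_iff.2 ?_)
  exact div_nonpos_of_nonpos_of_nonneg (neg_nonpos.2 (sq_nonneg _)) (by positivity)

theorem sq_mul_gaussianPDFReal_le (v : ℝ≥0) (z : ℝ) :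
    (z / v) ^ 2 * gaussianPDFReal 0 v z ≤ 2 / v * (√(2 * Real.pi * v))⁻¹ := by
  rcases eq_or_ne v 0 with rfl | hv
  · simp
  have hexp : z ^ 2 / (2 * v) * Real.exp (-(z ^ 2 / (2 * v))) ≤ 1 := by
    rw [Real.exp_neg, ← div_eq_mul_inv, div_le_one (Real.exp_pos _)]
    linarith [Real.add_one_le_exp (z ^ 2 / (2 * v))]
  calc (z / v) ^ 2 * gaussianPDFReal 0 v z
    _ = 2 / v * (√(2 * Real.pi * v))⁻¹ * (z ^ 2 / (2 * v) * Real.exp (-(z ^ 2 / (2 * v)))) := by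
        rw [gaussianPDFReal, sub_zero, neg_div]
        field_simp
    _ ≤ _ := mul_le_of_le_one_right (by positivity) hexp

/-- The density of `N(0, v)`. -/
noncomputable def gaussianKernel (v : ℝ≥0) : BoundedContinuousFunction ℝ ℝ :=
  .ofNormedAddCommGroup (gaussianPDFReal 0 v) (continuous_gaussianPDFReal 0 v)
    (√(2 * Real.pi * v))⁻¹ fun z => by
      rw [Real.norm_of_nonneg (gaussianPDFReal_nonneg _ _ _)]
      exact gaussianPDFReal_le 0 v z

/-- The density of the Fisher information of `N(0, v)`. -/
noncomputable def gaussianFisherKernel (v : ℝ≥0) : BoundedContinuousFunction ℝ ℝ :=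
  .ofNormedAddCommGroup (fun z => (z / v) ^ 2 * gaussianPDFReal 0 v z)
    (by have := continuous_gaussianPDFReal 0 v; fun_prop) (2 / v * (√(2 * Real.pi * v))⁻¹)
    fun z => by
      rw [Real.norm_of_nonneg (mul_nonneg (sq_nonneg _) (gaussianPDFReal_nonneg _ _ _))]
      exact sq_mul_gaussianPDFReal_le v z

/-- The derivative of the density of `N(0, v)`. -/
noncomputable def gaussianDerivKernel (v : ℝ≥0) : BoundedContinuousFunction ℝ ℝ :=
  .ofNormedAddCommGroup (fun z => -(z / v) * gaussianPDFReal 0 v z)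
    (by have := continuous_gaussianPDFReal 0 v; fun_prop)
    (‖gaussianKernel v‖ + ‖gaussianFisherKernel v‖) fun z => by
      have hk := (Real.le_norm_self _).trans ((gaussianKernel v).norm_coe_le_norm z)
      have hq := (Real.le_norm_self _).trans ((gaussianFisherKernel v).norm_coe_le_norm z)
      change gaussianPDFReal 0 v z ≤ _ at hk
      change (z / v) ^ 2 * gaussianPDFReal 0 v z ≤ _ at hq
      have h0 := gaussianPDFReal_nonneg 0 v z
      rw [norm_mul, norm_neg, Real.norm_of_nonneg h0, Real.norm_eq_abs]
      nlinarith [sq_abs (z / v), sq_nonneg (|z / (v : ℝ)| - 1), abs_nonneg (z / (v : ℝ))]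

variable {v : ℝ≥0}

theorem withDensity_gaussianKernel (hv : v ≠ 0) :
    volume.withDensity (fun z => ENNReal.ofReal (gaussianKernel v z)) = gaussianReal 0 v :=
  (gaussianReal_of_var_ne_zero 0 hv).symm

theorem lintegral_gaussianFisherKernel (hv : v ≠ 0) :
    ∫⁻ z, ENNReal.ofReal (gaussianFisherKernel v z) = ENNReal.ofReal (v : ℝ)⁻¹ := by
  have hint : Integrable (fun z : ℝ => z ^ 2) (gaussianReal 0 v) :=
    (memLp_id_gaussianReal' 2 (by simp)).integrable_sq
  have hsq : ∫ z, z ^ 2 ∂gaussianReal 0 v = v := by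
    rw [← variance_of_integral_eq_zero (X := fun z => z) (by fun_prop) integral_id_gaussianReal,
      variance_fun_id_gaussianReal]
  calc ∫⁻ z, ENNReal.ofReal (gaussianFisherKernel v z)
    _ = ∫⁻ z, ENNReal.ofReal ((z / v) ^ 2) ∂gaussianReal 0 v := by
        rw [gaussianReal_of_var_ne_zero 0 hv, lintegral_withDensity_eq_lintegral_mul _
          (measurable_gaussianPDF 0 v) (by fun_prop)]
        refine lintegral_congr fun z => ?_
        rw [Pi.mul_apply, gaussianPDF, ← ENNReal.ofReal_mul (gaussianPDFReal_nonneg _ _ _),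
          mul_comm]
        rfl
    _ = ENNReal.ofReal (∫ z, (z / v) ^ 2 ∂gaussianReal 0 v) := by
        refine (ofReal_integral_eq_lintegral_ofReal ?_ (ae_of_all _ fun z => sq_nonneg _)).symm
        simpa only [div_pow] using hint.div_const _
    _ = ENNReal.ofReal (v : ℝ)⁻¹ := by
        simp_rw [div_pow]
        rw [integral_div, hsq, pow_two, div_mul_cancel_left₀ (by exact_mod_cast hv)]

theorem fisherInfo_id_gaussianReal (hv : v ≠ 0) :
    fisherInfo id (gaussianReal 0 v) = ENNReal.ofReal (v : ℝ)⁻¹ := by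
  have hf : IsSmoothDensity (gaussianPDFReal 0 v) (gaussianReal 0 v) :=
    ⟨by rw [gaussianPDFReal_def]; fun_prop, gaussianPDFReal_nonneg _ _,
      gaussianReal_of_var_ne_zero 0 hv⟩
  rw [hf.fisherInfo_id_eq, ← lintegral_gaussianFisherKernel hv]
  refine lintegral_congr fun z => congrArg ENNReal.ofReal ?_
  rw [(hasDerivAt_gaussianPDFReal v z).deriv, mul_pow, neg_sq, mul_div_assoc, pow_two
    (gaussianPDFReal 0 v z), mul_self_div_self]
  rfl

theorem tendsto_fisherInfo_conv_gaussianReal (hv : v ≠ 0) {ι : Type*} {l : Filter ι}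
    [l.IsCountablyGenerated] {μs : ι → ProbabilityMeasure ℝ} {ν : ProbabilityMeasure ℝ}
    (h : Tendsto μs l (𝓝 ν)) :
    Tendsto (fun i => fisherInfo id ((μs i : Measure ℝ) ∗ gaussianReal 0 v)) l
      (𝓝 (fisherInfo id ((ν : Measure ℝ) ∗ gaussianReal 0 v))) := by
  rw [← withDensity_gaussianKernel hv]
  have : IsFiniteMeasure (volume.withDensity fun z => ENNReal.ofReal (gaussianKernel v z)) := by
    rw [withDensity_gaussianKernel hv]
    infer_instance
  refine tendsto_fisherInfo_conv (k' := gaussianDerivKernel v) (q := gaussianFisherKernel v)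
    (hasDerivAt_gaussianPDFReal v) (fun z => gaussianPDFReal_pos 0 v z hv) (fun z => ?_) ?_ h
  · change gaussianPDFReal 0 v z * ((z / v) ^ 2 * gaussianPDFReal 0 v z) =
      (-(z / v) * gaussianPDFReal 0 v z) ^ 2
    ring
  · rw [lintegral_gaussianFisherKernel hv]
    exact ENNReal.ofReal_ne_top

end Gaussian

section Tail

theorem tendsto_integral_comp_of_tendstoInDistribution {ι Ω Ω' : Type*} [MeasurableSpace Ω]
    [MeasurableSpace Ω'] {P : Measure Ω} [IsProbabilityMeasure P] {Q : Measure Ω'}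
    [IsProbabilityMeasure Q] {l : Filter ι} {U : ι → Ω → ℝ} {Y : Ω' → ℝ}
    (h : TendstoInDistribution U l Y (fun _ => P) Q) (g : BoundedContinuousFunction ℝ ℝ) :
    Tendsto (fun i => ∫ ω, g (U i ω) ∂P) l (𝓝 (∫ ω, g (Y ω) ∂Q)) := by
  have hg := ProbabilityMeasure.tendsto_iff_forall_integral_tendsto.1 h.tendsto g
  simp only [ProbabilityMeasure.coe_mk,
    integral_map h.aemeasurable_limit g.continuous.aestronglyMeasurable] at hg
  exact hg.congr fun i =>
    integral_map (h.forall_aemeasurable i) g.continuous.aestronglyMeasurable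

variable {Ω : Type*} [MeasurableSpace Ω] {P : Measure Ω}

theorem integrable_min_sq {U : Ω → ℝ} (hU : MemLp U 2 P) {K : ℝ} (hK : 0 ≤ K) :
    Integrable (fun ω => min (U ω ^ 2) K) P := by
  refine hU.integrable_sq.mono
    ((hU.aestronglyMeasurable.pow 2).inf aestronglyMeasurable_const) (ae_of_all _ fun ω => ?_)
  rw [Real.norm_of_nonneg (le_min (sq_nonneg _) hK), Real.norm_of_nonneg (sq_nonneg _)]
  exact min_le_left _ _

theorem tendsto_integral_min_sq {U : Ω → ℝ} (hU : MemLp U 2 P) :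
    Tendsto (fun K => ∫ ω, min (U ω ^ 2) K ∂P) atTop (𝓝 (∫ ω, U ω ^ 2 ∂P)) := by
  refine tendsto_integral_filter_of_dominated_convergence (fun ω => U ω ^ 2) ?_ ?_
    hU.integrable_sq (ae_of_all _ fun ω => ?_)
  · filter_upwards [eventually_ge_atTop 0] with K hK
    exact (integrable_min_sq hU hK).aestronglyMeasurable
  · filter_upwards [eventually_ge_atTop 0] with K hK
    refine ae_of_all _ fun ω => ?_
    rw [Real.norm_of_nonneg (le_min (sq_nonneg _) hK)]
    exact min_le_left _ _
  · refine tendsto_const_nhds.congr' ?_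
    filter_upwards [eventually_ge_atTop (U ω ^ 2)] with K hK
    exact (min_eq_left hK).symm

theorem setIntegral_sq_le_two_mul_sub {U : Ω → ℝ} (hU : MemLp U 2 P) {R K : ℝ} (hK : 0 ≤ K)
    (hR : √(2 * K) ≤ R) :
    ∫ ω in {ω | R ≤ |U ω|}, U ω ^ 2 ∂P ≤
      2 * (∫ ω, U ω ^ 2 ∂P - ∫ ω, min (U ω ^ 2) K ∂P) := by
  have hint : Integrable (fun ω => 2 * (U ω ^ 2 - min (U ω ^ 2) K)) P :=
    (hU.integrable_sq.sub (integrable_min_sq hU hK)).const_mul 2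
  rw [← integral_sub hU.integrable_sq (integrable_min_sq hU hK), ← integral_const_mul]
  have hset : NullMeasurableSet {ω | R ≤ |U ω|} P :=
    nullMeasurableSet_le aemeasurable_const hU.aestronglyMeasurable.aemeasurable.norm
  refine (setIntegral_mono_ae_restrict hU.integrable_sq.integrableOn hint.integrableOn ?_).trans
    (setIntegral_le_integral hint (ae_of_all _ fun ω => ?_))
  · filter_upwards [ae_restrict_mem₀ hset] with ω hω
    have hsq : 2 * K ≤ U ω ^ 2 := by
      rw [← sq_abs]
      exact (Real.sqrt_le_left ((Real.sqrt_nonneg _).trans (hR.trans hω))).1 (hR.trans hω)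
    linarith [min_le_right (U ω ^ 2) K]
  · exact mul_nonneg zero_le_two (sub_nonneg.2 (min_le_left _ _))

/-- The proportion of the second moment of a centred variable that is carried by the values of
modulus at least `R` standard deviations. -/
noncomputable def tailMoment (U : Ω → ℝ) (P : Measure Ω) (R : ℝ) : ℝ :=
  (∫ ω in {ω | R * √(Var[U; P]) ≤ |U ω|}, U ω ^ 2 ∂P) / Var[U; P]

theorem tailMoment_nonneg (U : Ω → ℝ) (R : ℝ) : 0 ≤ tailMoment U P R :=
  div_nonneg (integral_nonneg fun _ => sq_nonneg _) (variance_nonneg _ _)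

theorem tailMoment_le_one {U : Ω → ℝ} (hU : MemLp U 2 P) (hU0 : ∫ ω, U ω ∂P = 0) (R : ℝ) :
    tailMoment U P R ≤ 1 := by
  refine div_le_one_of_le₀ ?_ (variance_nonneg _ _)
  rw [variance_of_integral_eq_zero hU.aestronglyMeasurable.aemeasurable hU0]
  exact setIntegral_le_integral hU.integrable_sq (ae_of_all _ fun _ => sq_nonneg _)

variable [IsProbabilityMeasure P]

theorem tendsto_setIntegral_sq {ι Ω' : Type*} [MeasurableSpace Ω'] {Q : Measure Ω'}
    [IsProbabilityMeasure Q] {l : Filter ι} {U : ι → Ω → ℝ} {Y : Ω' → ℝ} {R : ι → ℝ}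
    (h : TendstoInDistribution U l Y (fun _ => P) Q) (hU : ∀ i, MemLp (U i) 2 P)
    (hY : MemLp Y 2 Q)
    (hsq : Tendsto (fun i => ∫ ω, U i ω ^ 2 ∂P) l (𝓝 (∫ ω, Y ω ^ 2 ∂Q)))
    (hR : Tendsto R l atTop) :
    Tendsto (fun i => ∫ ω in {ω | R i ≤ |U i ω|}, U i ω ^ 2 ∂P) l (𝓝 0) := by
  refine tendsto_order.2 ⟨fun b hb => Eventually.of_forall fun i =>
    hb.trans_le (integral_nonneg fun _ => sq_nonneg _), fun ε hε => ?_⟩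
  obtain ⟨K, hK, hK0⟩ := (((tendsto_integral_min_sq hY).eventually_const_lt
    (show ∫ ω, Y ω ^ 2 ∂Q - ε / 2 < _ by linarith)).and (eventually_ge_atTop 0)).exists
  let g : BoundedContinuousFunction ℝ ℝ :=
    .ofNormedAddCommGroup (fun z => min (z ^ 2) K) (by fun_prop) K fun z => by
      rw [Real.norm_of_nonneg (le_min (sq_nonneg _) hK0)]
      exact min_le_right _ _
  have hlim : Tendsto (fun i => 2 * (∫ ω, U i ω ^ 2 ∂P - ∫ ω, min (U i ω ^ 2) K ∂P)) l
      (𝓝 (2 * (∫ ω, Y ω ^ 2 ∂Q - ∫ ω, min (Y ω ^ 2) K ∂Q))) :=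
    (hsq.sub (tendsto_integral_comp_of_tendstoInDistribution h g)).const_mul 2
  filter_upwards [hlim.eventually_lt_const (show _ < ε by linarith),
    hR.eventually_ge_atTop (√(2 * K))] with i hi hRi
  exact (setIntegral_sq_le_two_mul_sub (hU i) hK0 hRi).trans_lt hi

theorem tendsto_tailMoment {ι Ω' : Type*} [MeasurableSpace Ω'] {Q : Measure Ω'}
    [IsProbabilityMeasure Q] {l : Filter ι} {U : ι → Ω → ℝ} {Y : Ω' → ℝ} {R : ι → ℝ}
    (h : TendstoInDistribution U l Y (fun _ => P) Q) (hU : ∀ i, MemLp (U i) 2 P)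
    (hU0 : ∀ i, ∫ ω, U i ω ∂P = 0) (hY : MemLp Y 2 Q) (hY0 : ∫ ω, Y ω ∂Q = 0)
    (hvar : Tendsto (fun i => Var[U i; P]) l (𝓝 Var[Y; Q])) (hpos : 0 < Var[Y; Q])
    (hR : Tendsto R l atTop) : Tendsto (fun i => tailMoment (U i) P (R i)) l (𝓝 0) := by
  have hsq : Tendsto (fun i => ∫ ω, U i ω ^ 2 ∂P) l (𝓝 (∫ ω, Y ω ^ 2 ∂Q)) := by
    simpa only [variance_of_integral_eq_zero h.aemeasurable_limit hY0,
      fun i => variance_of_integral_eq_zero (h.forall_aemeasurable i) (hU0 i)] using hvar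
  rw [← zero_div Var[Y; Q]]
  exact (tendsto_setIntegral_sq h hU hY hsq
    (hR.atTop_mul_pos (Real.sqrt_pos.2 hpos) hvar.sqrt)).div hvar hpos.ne'

theorem exists_memClass_of_tendsto_tailMoment {ι : Type*} {U : ι → Ω → ℝ}
    (hU : ∀ i, MemLp (U i) 2 P) (hU0 : ∀ i, ∫ ω, U i ω ∂P = 0) (hpos : ∀ i, 0 < Var[U i; P])
    (h : Tendsto (fun p : ι × ℝ => tailMoment (U p.1) P p.2) (cofinite ×ˢ atTop) (𝓝 0)) :
    ∃ ψ : ℝ → ℝ, Tendsto ψ atTop (𝓝 0) ∧ ∀ i, MemClass ψ (U i) P := by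
  refine ⟨fun R => ⨆ i, tailMoment (U i) P R, tendsto_order.2 ⟨fun b hb =>
    Eventually.of_forall fun R => hb.trans_le (Real.iSup_nonneg fun i => tailMoment_nonneg _ _),
    fun ε hε => ?_⟩, fun i => ⟨hU i, fun R => ?_⟩⟩
  · obtain ⟨δ, hδ0, hδ⟩ := exists_between hε
    obtain ⟨p, hp, q, hq, hpq⟩ := eventually_prod_iff.1 (h.eventually_lt_const hδ0)
    have hsingle : ∀ i, Tendsto (tailMoment (U i) P) atTop (𝓝 0) := fun i =>
      tendsto_tailMoment (tendstoInDistribution_const (hU i).aestronglyMeasurable.aemeasurable)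
        (fun _ => hU i) (fun _ => hU0 i) (hU i) (hU0 i) tendsto_const_nhds (hpos i) tendsto_id
    filter_upwards [hq, (eventually_all_finite (eventually_cofinite.1 hp)).2 fun i _ =>
      (hsingle i).eventually_lt_const hδ0] with R hqR hfin
    refine (Real.iSup_le (fun i => ?_) hδ0.le).trans_lt hδ
    by_cases hi : p i
    · exact (hpq hi hqR).le
    · exact (hfin i hi).le
  · have hbdd : BddAbove (Set.range fun i => tailMoment (U i) P R) :=
      ⟨1, Set.forall_mem_range.2 fun i => tailMoment_le_one (hU i) (hU0 i) R⟩
    rw [← div_le_iff₀' (hpos i)]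
    exact le_ciSup hbdd i

end Tail

section LargeBoxes

variable {d : ℕ}

theorem exists_boxVolume_eq (hd : 0 < d) (n : ℕ) : ∃ x : Fin d → ℕ, boxVolume x = n := by
  refine ⟨Function.update 1 ⟨0, hd⟩ n, ?_⟩
  rw [boxVolume, Finset.prod_update_of_mem (Finset.mem_univ _)]
  simp

theorem tendsto_iSup_of_tendsto_largeBoxes {α : Type*} [CompleteLinearOrder α]
    [TopologicalSpace α] [OrderTopology α] [DenselyOrdered α] (hd : 0 < d) {F : (Fin d → ℕ) → α}
    {a : α} (hF : Tendsto F (largeBoxes d) (𝓝 a)) :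
    Tendsto (fun n : ℕ => ⨆ (x : Fin d → ℕ) (_ : boxVolume x = n), F x) atTop (𝓝 a) := by
  refine tendsto_order.2 ⟨fun b hb => ?_, fun b hb => ?_⟩
  · filter_upwards [eventually_comap.1 (hF.eventually_const_lt hb)] with n hn
    obtain ⟨x, hx⟩ := exists_boxVolume_eq hd n
    exact (hn x hx).trans_le (le_iSup₂ (f := fun x _ => F x) x hx)
  · obtain ⟨c, hac, hcb⟩ := exists_between hb
    filter_upwards [eventually_comap.1 (hF.eventually_lt_const hac)] with n hn
    exact (iSup₂_le fun x hx => (hn x hx).le).trans_lt hcb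

theorem tendsto_val_cofinite_largeBoxes :
    Tendsto (Subtype.val : {x : Fin d → ℕ // ∀ i, 0 < x i} → Fin d → ℕ) cofinite
      (largeBoxes d) := by
  refine tendsto_comap_iff.2 (tendsto_atTop.2 fun N => eventually_cofinite.2 ?_)
  have hfin : (Subtype.val ⁻¹' (Fintype.piFinset fun _ : Fin d => Finset.range N : Set _) :
      Set {x : Fin d → ℕ // ∀ i, 0 < x i}).Finite :=
    (Finset.finite_toSet _).preimage Subtype.val_injective.injOn
  refine hfin.subset fun x hx => ?_
  simp only [Set.mem_preimage, Finset.mem_coe, Fintype.mem_piFinset, Finset.mem_range]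
  exact fun i => (Nat.le_of_dvd (boxVolume_pos x.2)
    (Finset.dvd_prod_of_mem x.1 (Finset.mem_univ i))).trans_lt (not_le.1 hx)

end LargeBoxes

section Perturbation

variable {d : ℕ} {Ω : Type*}

theorem perturbedSum_eq (X Z : (Fin d → ℤ) → Ω → ℝ) (x : Fin d → ℕ) :
    perturbedSum X Z x = normSum X x + normSum Z x := by
  ext ω
  simp only [perturbedSum, Pi.add_apply, normSum, boxSum, Finset.sum_add_distrib]
  ring

variable [MeasurableSpace Ω]

/-- `Z` is a family of independent `N(0, τ)` variables, independent of the field `X`. -/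
structure IsPerturbation (X Z : (Fin d → ℤ) → Ω → ℝ) (τ : ℝ≥0) (P : Measure Ω) : Prop where
  hasLaw : ∀ u, HasLaw (Z u) (gaussianReal 0 τ) P
  indep : iIndepFun Z P
  indep_field : IndepFun (fun ω u => X u ω) (fun ω u => Z u ω) P

variable {X Z : (Fin d → ℤ) → Ω → ℝ} {P : Measure Ω} {τ : ℝ≥0}

namespace IsPerturbation

variable (hZ : IsPerturbation X Z τ P)
include hZ

theorem memLp (u : Fin d → ℤ) : MemLp (Z u) 2 P := by
  have hid : MemLp id 2 (P.map (Z u)) := by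
    rw [(hZ.hasLaw u).map_eq]
    exact memLp_id_gaussianReal' 2 (by simp)
  exact (memLp_map_measure_iff (by fun_prop) (hZ.hasLaw u).aemeasurable).1 hid

theorem memLp_normSum (x : Fin d → ℕ) : MemLp (normSum Z x) 2 P :=
  (memLp_finsetSum _ fun u _ => hZ.memLp u).const_mul _

theorem integral_normSum [IsFiniteMeasure P] (x : Fin d → ℕ) :
    ∫ ω, normSum Z x ω ∂P = 0 := by
  have hint : ∀ u ∈ box x, Integrable (Z u) P := fun u _ => (hZ.memLp u).integrable one_le_two
  simp_rw [normSum, boxSum, integral_const_mul, integral_finsetSum _ hint,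
    (hZ.hasLaw _).integral_eq, integral_id_gaussianReal, Finset.sum_const_zero, mul_zero]

theorem indepFun_normSum (x : Fin d → ℕ) : IndepFun (normSum X x) (normSum Z x) P := by
  have hm : Measurable fun z : (Fin d → ℤ) → ℝ => (√(boxVolume x))⁻¹ * ∑ u ∈ box x, z u := by
    fun_prop
  exact hZ.indep_field.comp hm hm

theorem hasLaw_boxSum [IsProbabilityMeasure P] (x : Fin d → ℕ) :
    HasLaw (boxSum Z x) (gaussianReal 0 (boxVolume x * τ)) P := by
  have hm : AEMeasurable (boxSum Z x) P :=
    Finset.aemeasurable_fun_sum _ fun u _ => (hZ.hasLaw u).aemeasurable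
  refine ⟨hm, ?_⟩
  have : IsProbabilityMeasure (P.map (boxSum Z x)) := Measure.isProbabilityMeasure_map hm
  refine Measure.ext_of_charFun ?_
  change charFun (P.map fun ω => ∑ u ∈ box x, Z u ω) = _
  rw [(hZ.indep.restrict _).charFun_map_fun_finsetSum_eq_prod
    fun u _ => (hZ.hasLaw u).aemeasurable]
  ext t
  simp only [Finset.prod_apply, (hZ.hasLaw _).map_eq, Finset.prod_const, card_box,
    charFun_gaussianReal, ← Complex.exp_nat_mul]
  push_cast
  ring_nf

theorem hasLaw_normSum [IsProbabilityMeasure P] {x : Fin d → ℕ} (hx : ∀ i, 0 < x i) :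
    HasLaw (normSum Z x) (gaussianReal 0 τ) P := by
  have hV : (boxVolume x : ℝ) ≠ 0 := by exact_mod_cast (boxVolume_pos hx).ne'
  have hvar : NNReal.mk ((√(boxVolume x))⁻¹ ^ 2) (sq_nonneg _) * (boxVolume x * τ) = τ := by
    refine NNReal.eq ?_
    push_cast
    rw [inv_pow, Real.sq_sqrt (Nat.cast_nonneg _), inv_mul_cancel_left₀ hV]
  have hlaw := gaussianReal_const_mul (hZ.hasLaw_boxSum x) (√(boxVolume x))⁻¹
  rwa [mul_zero, hvar] at hlaw

end IsPerturbation

variable (h : IsFKGSystem X P) (hZ : IsPerturbation X Z τ P)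

section Moments

include h hZ

theorem memLp_perturbedSum (x : Fin d → ℕ) : MemLp (perturbedSum X Z x) 2 P := by
  rw [perturbedSum_eq]
  exact (h.memLp_normSum x).add (hZ.memLp_normSum x)

variable [IsProbabilityMeasure P]

theorem integral_perturbedSum (x : Fin d → ℕ) : ∫ ω, perturbedSum X Z x ω ∂P = 0 := by
  rw [perturbedSum_eq, integral_add' ((h.memLp_normSum x).integrable one_le_two)
    ((hZ.memLp_normSum x).integrable one_le_two), h.integral_normSum, hZ.integral_normSum,
    add_zero]

theorem map_perturbedSum {x : Fin d → ℕ} (hx : ∀ i, 0 < x i) :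
    P.map (perturbedSum X Z x) = P.map (normSum X x) ∗ gaussianReal 0 τ := by
  rw [perturbedSum_eq, ← (hZ.hasLaw_normSum hx).map_eq]
  exact (hZ.indepFun_normSum x).map_add_eq_map_conv_map₀ (h.measurable_normSum x).aemeasurable
    (hZ.hasLaw_normSum hx).aemeasurable

theorem variance_perturbedSum {x : Fin d → ℕ} (hx : ∀ i, 0 < x i) :
    Var[perturbedSum X Z x; P] = Var[normSum X x; P] + τ := by
  rw [perturbedSum_eq, (hZ.indepFun_normSum x).variance_add (h.memLp_normSum x)
    (hZ.memLp_normSum x), (hZ.hasLaw_normSum hx).variance_eq, variance_id_gaussianReal]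

end Moments

variable [IsProbabilityMeasure P]

namespace IsFKGSystem

include h

theorem tendsto_of_forall_tendsto_variance {ι E : Type*} [TopologicalSpace E] {l : Filter ι}
    [l.IsCountablyGenerated] {x : ι → Fin d → ℕ} {F : ι → E} {a : E}
    (hF : ∀ (u : ℕ → ι) (s : ℝ≥0), Tendsto u atTop l →
      Tendsto (fun n => Var[normSum X (x (u n)); P]) atTop (𝓝 s) →
        Tendsto (fun n => F (u n)) atTop (𝓝 a)) :
    Tendsto F l (𝓝 a) := by
  refine tendsto_of_subseq_tendsto fun u hu => ?_
  obtain ⟨s, hs, φ, hφ, hlim⟩ := (isCompact_Icc (a := (0 : ℝ))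
    (b := ∑' u, cov[X 0, X u; P])).tendsto_subseq (x := fun n => Var[normSum X (x (u n)); P])
    fun n => ⟨variance_nonneg _ _, h.variance_normSum_le _⟩
  exact ⟨φ, hF _ ⟨s, hs.1⟩ (hu.comp hφ.tendsto_atTop) hlim⟩

variable {x : ℕ → Fin d → ℕ} (hx : Tendsto x atTop (largeBoxes d)) {s : ℝ≥0}
  (hs : Tendsto (fun n => Var[normSum X (x n); P]) atTop (𝓝 s))
include hx hs

theorem tendstoInDistribution_normSum :
    TendstoInDistribution (fun n => normSum X (x n)) atTop id (fun _ => P) (gaussianReal 0 s) := by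
  refine ⟨fun n => (h.measurable_normSum _).aemeasurable, aemeasurable_id,
    ProbabilityMeasure.tendsto_of_tendsto_charFun fun t => ?_⟩
  have hlim := h.tendsto_charFun_normSum hx (tendsto_map'_iff.2 hs) t
  have hchar : charFun (gaussianReal 0 s) t = Complex.exp (-(t ^ 2 * s / 2 : ℝ)) := by
    rw [charFun_gaussianReal]
    push_cast
    ring_nf
  simp only [ProbabilityMeasure.coe_mk, Measure.map_id, hchar]
  exact tendsto_map'_iff.1 hlim

end IsFKGSystem

theorem eventually_forall_pos_of_tendsto_largeBoxes {ι : Type*} {l : Filter ι}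
    {x : ι → Fin d → ℕ} (hx : Tendsto x l (largeBoxes d)) : ∀ᶠ n in l, ∀ i, 0 < x n i :=
  (hx.eventually eventually_boxVolume_pos_largeBoxes).mono fun _ => pos_of_boxVolume_pos

section Limits

variable {x : ℕ → Fin d → ℕ} (hx : Tendsto x atTop (largeBoxes d)) {s : ℝ≥0}
  (hs : Tendsto (fun n => Var[normSum X (x n); P]) atTop (𝓝 s))
include h hZ hx hs

theorem tendsto_variance_perturbedSum :
    Tendsto (fun n => Var[perturbedSum X Z (x n); P]) atTop (𝓝 ((s + τ : ℝ≥0) : ℝ)) := by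
  rw [NNReal.coe_add]
  refine (hs.add_const _).congr' ?_
  filter_upwards [eventually_forall_pos_of_tendsto_largeBoxes hx] with n hn
  exact (variance_perturbedSum h hZ hn).symm

theorem tendstoInDistribution_perturbedSum :
    TendstoInDistribution (fun n => perturbedSum X Z (x n)) atTop id (fun _ => P)
      (gaussianReal 0 (s + τ)) := by
  refine ⟨fun n => (memLp_perturbedSum h hZ _).aestronglyMeasurable.aemeasurable, aemeasurable_id,
    ProbabilityMeasure.tendsto_of_tendsto_charFun fun t => ?_⟩
  have hlim := (ProbabilityMeasure.tendsto_iff_tendsto_charFun.1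
    (h.tendstoInDistribution_normSum hx hs).tendsto t).mul_const (charFun (gaussianReal 0 τ) t)
  simp only [ProbabilityMeasure.coe_mk, Measure.map_id, ← charFun_conv,
    gaussianReal_conv_gaussianReal, add_zero] at hlim ⊢
  refine hlim.congr' ?_
  filter_upwards [eventually_forall_pos_of_tendsto_largeBoxes hx] with n hn
  rw [map_perturbedSum h hZ hn]

theorem tendsto_fisherInfo_perturbedSum (hτ : 0 < τ) :
    Tendsto (fun n => fisherInfo (perturbedSum X Z (x n)) P) atTop
      (𝓝 (ENNReal.ofReal (s + τ : ℝ≥0)⁻¹)) := by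
  have hlim := tendsto_fisherInfo_conv_gaussianReal hτ.ne'
    (h.tendstoInDistribution_normSum hx hs).tendsto
  simp only [ProbabilityMeasure.coe_mk, Measure.map_id, gaussianReal_conv_gaussianReal, add_zero,
    fisherInfo_id_gaussianReal (add_pos_of_nonneg_of_pos zero_le hτ).ne'] at hlim
  refine hlim.congr' ?_
  filter_upwards [eventually_forall_pos_of_tendsto_largeBoxes hx] with n hn
  rw [← map_perturbedSum h hZ hn,
    fisherInfo_id_map (memLp_perturbedSum h hZ _).aestronglyMeasurable.aemeasurable]

end Limits

include h hZ

theorem tendsto_variance_mul_fisherInfo (hτ : 0 < τ) :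
    Tendsto (fun x => ENNReal.ofReal Var[perturbedSum X Z x; P] *
      fisherInfo (perturbedSum X Z x) P) (largeBoxes d) (𝓝 1) := by
  refine h.tendsto_of_forall_tendsto_variance (x := id) fun u s hu hs => ?_
  have hpos : (0 : ℝ) < (s + τ : ℝ≥0) := add_pos_of_nonneg_of_pos s.2 hτ
  have hlim := ENNReal.Tendsto.mul
    (ENNReal.tendsto_ofReal (tendsto_variance_perturbedSum h hZ hu hs))
    (Or.inr ENNReal.ofReal_ne_top) (tendsto_fisherInfo_perturbedSum h hZ hu hs hτ)
    (Or.inr ENNReal.ofReal_ne_top)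
  rwa [← ENNReal.ofReal_mul hpos.le, mul_inv_cancel₀ hpos.ne', ENNReal.ofReal_one] at hlim

theorem tendsto_stdFisherInfo (hτ : 0 < τ) :
    Tendsto (fun x => stdFisherInfo (perturbedSum X Z x) P) (largeBoxes d) (𝓝 0) := by
  have hsub : Tendsto (fun a : EReal => a - 1) (𝓝 1) (𝓝 (1 - 1)) :=
    (EReal.continuousAt_add (p := (1, -1)) (Or.inl (by decide)) (Or.inl (by decide))).tendsto.comp
      ((continuous_id.prodMk continuous_const).tendsto (1 : EReal))
  have hone : (1 : EReal) - 1 = 0 := by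
    rw [← EReal.coe_one, ← EReal.coe_sub, sub_self, EReal.coe_zero]
  rw [hone] at hsub
  exact hsub.comp ((continuous_coe_ennreal_ereal.tendsto 1).comp
    (tendsto_variance_mul_fisherInfo h hZ hτ))

theorem tendsto_tailMoment_perturbedSum (hτ : 0 < τ) :
    Tendsto (fun p : (Fin d → ℕ) × ℝ => tailMoment (perturbedSum X Z p.1) P p.2)
      (largeBoxes d ×ˢ atTop) (𝓝 0) := by
  refine h.tendsto_of_forall_tendsto_variance (x := Prod.fst) fun u s hu hs => ?_
  have hx : Tendsto (fun n => (u n).1) atTop (largeBoxes d) := tendsto_fst.comp hu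
  have hvar := tendsto_variance_perturbedSum h hZ hx hs
  rw [← variance_id_gaussianReal (μ := 0)] at hvar
  refine tendsto_tailMoment (tendstoInDistribution_perturbedSum h hZ hx hs)
    (fun _ => memLp_perturbedSum h hZ _) (fun _ => integral_perturbedSum h hZ _)
    (memLp_id_gaussianReal' 2 (by simp)) integral_id_gaussianReal hvar ?_ (tendsto_snd.comp hu)
  rw [variance_id_gaussianReal]
  exact add_pos_of_nonneg_of_pos s.2 hτ

theorem exists_memClass_perturbedSum (hτ : 0 < τ) :
    ∃ ψ : ℝ → ℝ, Tendsto ψ atTop (𝓝 0) ∧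
      ∀ x : Fin d → ℕ, (∀ i, 0 < x i) → MemClass ψ (perturbedSum X Z x) P := by
  have hpos : ∀ x : {x : Fin d → ℕ // ∀ i, 0 < x i}, 0 < Var[perturbedSum X Z x; P] := fun x => by
    rw [variance_perturbedSum h hZ x.2]
    exact add_pos_of_nonneg_of_pos (variance_nonneg _ _) hτ
  obtain ⟨ψ, hψ, hmem⟩ := exists_memClass_of_tendsto_tailMoment
    (fun x : {x : Fin d → ℕ // ∀ i, 0 < x i} => memLp_perturbedSum h hZ x)
    (fun x => integral_perturbedSum h hZ x) hpos
    ((tendsto_tailMoment_perturbedSum h hZ hτ).comp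
      (tendsto_val_cofinite_largeBoxes.prodMap tendsto_id))
  exact ⟨ψ, hψ, fun x hx => hmem ⟨x, hx⟩⟩

end Perturbation

end FKGField

theorem theorem1p7_general {d : ℕ} (hd : 0 < d) {Ω : Type*} [MeasurableSpace Ω] {P : Measure Ω}
    [IsProbabilityMeasure P] {X Z : (Fin d → ℤ) → Ω → ℝ} {τ : ℝ≥0} (hτ : 0 < τ)
    (h : FKGField.IsFKGSystem X P) (hZ : FKGField.IsPerturbation X Z τ P) :
    Tendsto (fun n : ℕ => ⨆ (x : Fin d → ℕ) (_ : FKGField.boxVolume x = n),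
        FKGField.stdFisherInfo (FKGField.perturbedSum X Z x) P) atTop (𝓝 (0 : EReal)) ∧
      ∃ ψ : ℝ → ℝ, Tendsto ψ atTop (𝓝 0) ∧
        ∀ x : Fin d → ℕ, (∀ i, 0 < x i) →
          FKGField.MemClass ψ (FKGField.perturbedSum X Z x) P :=
  ⟨FKGField.tendsto_iSup_of_tendsto_largeBoxes hd (FKGField.tendsto_stdFisherInfo h hZ hτ),
    FKGField.exists_memClass_perturbedSum h hZ hτ⟩

theorem theorem1p7 {d : ℕ} (hd : 0 < d)
    {Ω : Type*} [MeasurableSpace Ω] (P : Measure Ω) [IsProbabilityMeasure P]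
    (X Z : (Fin d → ℤ) → Ω → ℝ) (τ : ℝ≥0) (hτ : 0 < τ)
    -- the field: stationary, mean zero, finite variance, FKG, finite susceptibility
    (hXmeas : ∀ u, Measurable (X u))
    (hXstat : FKGField.IsStationary X P)
    (hXvar : ∀ u, MemLp (X u) 2 P)
    (hXmean : ∀ u, ∫ ω, X u ω ∂P = 0)
    (hXfkg : FKGField.IsFKG X P)
    (hXsus : Summable fun u : Fin d → ℤ => cov[X 0, X u; P])
    -- the perturbation: `Z u ∼ N(0, τ)`, independent of each other and of the field
    (hZmeas : ∀ u, Measurable (Z u))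
    (hZlaw : ∀ u, P.map (Z u) = gaussianReal 0 τ)
    (hZindep : iIndepFun Z P)
    (hXZ : IndepFun (fun ω u => X u ω) (fun ω u => Z u ω) P) :
    Tendsto (fun n : ℕ => ⨆ (x : Fin d → ℕ) (_ : FKGField.boxVolume x = n),
        FKGField.stdFisherInfo (FKGField.perturbedSum X Z x) P) atTop (𝓝 (0 : EReal)) ↔
      ∃ ψ : ℝ → ℝ, Tendsto ψ atTop (𝓝 0) ∧
        ∀ x : Fin d → ℕ, (∀ i, 0 < x i) →
          FKGField.MemClass ψ (FKGField.perturbedSum X Z x) P :=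
  have hboth := theorem1p7_general hd hτ ⟨hXmeas, hXstat, hXvar, hXmean, hXfkg, hXsus⟩
    ⟨fun u => ⟨(hZmeas u).aemeasurable, hZlaw u⟩, hZindep, hXZ⟩
  iff_of_true hboth.1 hboth.2
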